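/- Let $X$ be a finite set. A \emph{polymatroid} on $X$ is a function $h:2^X\to\mathbb R_{\ge 0}$ with $h(\emptyset)=0$, $h(A)\le h(B)$ for $A\subseteq B$, and $h(A\cup B)+h(A\cap B)\le h(A)+h(B)$ for all $A,B\subseteq X$. It is \emph{Ingletonian} if for all $A_1,A_2,A_3,A_4\subseteq X$ \[ \begin{aligned} &h(A_1)+h(A_2)+h(A_3\cup A_4)+h(A_1\cup A_2\cup A_3)+h(A_1\cup A_2\cup A_4)\\ &\quad\le h(A_1\cup A_2)+h(A_1\cup A_3)+h(A_1\cup A_4)+h(A_2\cup A_3)+h(A_2\cup A_4). \end{aligned} \] It is \emph{representable} if there are a finite field $\mathbb F$, a finite-dimensional $\mathbb F$-vector space and subspaces $(V_i)_{i\in X}$ of it with $h(A)=\dim\langle V_i : i\in A\rangle$ for all $A\subseteq X$. It is \emph{cc-representable} if it lies in the closure, in $\mathbb R^{2^X}$, of the convex cone generated by the representable rank functions on $X$. \textbf{Theorem (Insufficiency of Ingleton's inequalities).} (1) There exist a finite set $X$ and an Ingletonian polymatroid on $X$ that is not cc-representable. (2) Consequently, there exist a finite set $X$ and real coefficients $(c_A)_{A\subseteq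 X}$ such that $\sum_{A\subseteq X}c_A h(A)\ge 0$ for every representable polymatroid $h$ on $X$, but this inequality is not implied by Ingleton's inequalities: some Ingletonian polymatroid $h$ on $X$ has $\sum_{A\subseteq X}c_A h(A)<0$. (3) Explicitly, let $u_1,u_2,u_3$ be linearly independent vectors over a finite field of characteristic $2$, and let $\Phi_1$ be the rank function (dimension of the span) of the seven lines spanned by \[u_1,\;u_2,\;u_3,\;u_1+u_2,\;u_2+u_3,\;u_1+u_2+u_3,\;u_1+u_3\] (the Fano matroid). Let $v_1,\dots,v_5$ be linearly independent vectors over a finite field of odd characteristic, and let $\Phi_2$ be the rank function of the thirteen lines spanned by \[v_1,\dots,v_5,\;v_1+v_2+v_3,\;v_3+v_4+v_5,\;v_1+v_2,\;v_1+v_3,\;v_2+v_3,\;v_3+v_4,\;v_3+v_5,\;v_4+v_5\] (the second Dougherty--Freiling--Zeger matroid). Let $X_1,X_2$ be the (disjoint) ground sets of $\Phi_1,\Phi_2$, let $X=X_1\sqcup X_2$, and let $\Phi(A)=\Phi_1(A\cap X_1)+\Phi_2(A\cap X_2)$ be the direct sum. Then for every real $\epsilon$ with $0<\epsilon\le\min(\Phi_1(X_1),\Phi_2(X_2))$,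 the $\epsilon$-perturbation \[\Phi^{\epsilon}(A)=\min\bigl(\Phi(A),\,\Phi(X)-\epsilon\bigr),\qquad A\subseteq X,\] is an Ingletonian polymatroid that is not cc-representable, and there are real coefficients $(c_A)_{A\subseteq X}$ such that $\sum_{A\subseteq X} c_A h(A)\ge 0$ for every representable polymatroid $h$ on $X$ while $\sum_{A\subseteq X} c_A\Phi^{\epsilon}(A)<0$. -/

import Mathlib

open scoped BigOperators

noncomputable section

namespace Polymat

/-- Rank functions over a ground set `X`, viewed as points of the real Euclidean space
whose coordinates are indexed by the subsets of `X`. -/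
abbrev RankFun (X : Type*) := Finset X → ℝ

/-- The polymatroid axioms. -/
structure IsPolymatroid {X : Type*} [DecidableEq X] (h : RankFun X) : Prop where
  nonneg : ∀ A, 0 ≤ h A
  empty : h ∅ = 0
  mono : ∀ A B, A ⊆ B → h A ≤ h B
  submodular : ∀ A B, h (A ∪ B) + h (A ∩ B) ≤ h A + h B

/-- The Ingleton expression `J_h(A₁, A₂, A₃, A₄)`. -/
def ingleton {X : Type*} [DecidableEq X] (h : RankFun X) (A₁ A₂ A₃ A₄ : Finset X) : ℝ :=
  h (A₁ ∪ A₂) + h (A₁ ∪ A₃) + h (A₁ ∪ A₄) + h (A₂ ∪ A₃) + h (A₂ ∪ A₄)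
    - h A₁ - h A₂ - h (A₃ ∪ A₄) - h (A₁ ∪ A₂ ∪ A₃) - h (A₁ ∪ A₂ ∪ A₄)

/-- An Ingletonian polymatroid: a polymatroid satisfying every Ingleton inequality. -/
structure IsIngletonian {X : Type*} [DecidableEq X] (h : RankFun X) : Prop where
  isPolymatroid : IsPolymatroid h
  ingleton_nonneg : ∀ A₁ A₂ A₃ A₄, 0 ≤ ingleton h A₁ A₂ A₃ A₄

/-- The rank function of a family of subspaces: `A ↦ dim ⟨V i, i ∈ A⟩`. -/
def subspaceRank (F : Type*) {W X : Type*} [Field F] [AddCommGroup W] [Module F W]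
    (V : X → Submodule F W) : RankFun X :=
  fun A => (Module.finrank F (⨆ i ∈ A, V i : Submodule F W) : ℝ)

/-- `h` is `q`-representable: it is the rank function of a family of subspaces of a
finite-dimensional vector space over a field with `q` elements. -/
def IsQRepresentable {X : Type*} (q : ℕ) (h : RankFun X) : Prop :=
  ∃ (F : Type) (_ : Field F) (_ : Finite F) (W : Type) (_ : AddCommGroup W) (_ : Module F W)
    (_ : FiniteDimensional F W) (V : X → Submodule F W),
    Nat.card F = q ∧ h = subspaceRank F V

/-- `h` is representable over some finite field. -/
def IsRepresentable {X : Type*} (h : RankFun X) : Prop :=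
  ∃ q : ℕ, IsQRepresentable q h

/-- `h` lies in the closure of the convex cone generated by the representable rank functions. -/
def IsCCRepresentable {X : Type*} (h : RankFun X) : Prop :=
  h ∈ closure (ConvexCone.hull ℝ {g : RankFun X | IsRepresentable g} : Set (RankFun X))

/-- The linear form `∑_A c_A h(A)`; the linear inequality with coefficients `c` says that it
is nonnegative. -/
def linearForm {X : Type*} [Fintype X] (c : Finset X → ℝ) (h : RankFun X) : ℝ :=
  ∑ A : Finset X, c A * h A

/-- The inequality `∑_A c_A h(A) ≥ 0` holds for all representable polymatroids over `X`. -/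
def IsSubspaceRankInequality {X : Type*} [Fintype X] (c : Finset X → ℝ) : Prop :=
  ∀ h : RankFun X, IsRepresentable h → 0 ≤ linearForm c h

/-- The inequality `∑_A c_A h(A) ≥ 0` is implied by Ingleton's inequalities (together with the
polymatroid axioms). -/
def IsImpliedByIngleton {X : Type*} [Fintype X] [DecidableEq X] (c : Finset X → ℝ) : Prop :=
  ∀ h : RankFun X, IsIngletonian h → 0 ≤ linearForm c h

/-- The `ε`-perturbation `A ↦ min (h A) (h X - ε)`. -/
def perturb {X : Type*} [Fintype X] (ε : ℝ) (h : RankFun X) : RankFun X :=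
  fun A => min (h A) (h Finset.univ - ε)

/-- The direct sum `A ↦ h₁ (A ∩ X₁) + h₂ (A ∩ X₂)` over the disjoint union of ground sets. -/
def directSum {X₁ X₂ : Type*} (h₁ : RankFun X₁) (h₂ : RankFun X₂) : RankFun (X₁ ⊕ X₂) :=
  fun A => h₁ A.toLeft + h₂ A.toRight

/-- The ground set `{Y₁, Y₂, Y₃, W₁, …, W₄}`. -/
abbrev Ground₁ := Fin 3 ⊕ Fin 4

/-- The ground set `{Z₁, …, Z₅, V₁, …, V₈}`. -/
abbrev Ground₂ := Fin 5 ⊕ Fin 8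

/-- The vectors spanning `Y₁, Y₂, Y₃` and `W₁, …, W₄`. -/
def vectors₁ {W : Type*} [AddCommGroup W] (u : Fin 3 → W) : Ground₁ → W :=
  Sum.elim u ![u 0 + u 1, u 1 + u 2, u 0 + u 1 + u 2, u 0 + u 2]

/-- The vectors spanning `Z₁, …, Z₅` and `V₁, …, V₈`. -/
def vectors₂ {W : Type*} [AddCommGroup W] (u : Fin 5 → W) : Ground₂ → W :=
  Sum.elim u ![u 0 + u 1 + u 2, u 2 + u 3 + u 4, u 0 + u 1, u 0 + u 2, u 1 + u 2,
    u 2 + u 3, u 2 + u 4, u 3 + u 4]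

/-- `Φ₁`: the Fano matroid when `u` is linearly independent over a field of characteristic 2. -/
def Φ₁ (F : Type*) {W : Type*} [Field F] [AddCommGroup W] [Module F W] (u : Fin 3 → W) :
    RankFun Ground₁ :=
  subspaceRank F fun i => Submodule.span F {vectors₁ u i}

/-- `Φ₂`: the second Dougherty-Freiling-Zeger matroid when `u` is linearly independent over a
field of odd characteristic. -/
def Φ₂ (F : Type*) {W : Type*} [Field F] [AddCommGroup W] [Module F W] (u : Fin 5 → W) :
    RankFun Ground₂ :=
  subspaceRank F fun i => Submodule.span F {vectors₂ u i}

end Polymat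

end

/-! The Fano matroid needs characteristic 2, and the two non-Fano matroids glued along one point in
`Φ₂` need characteristic different from 2. Both obstructions are made quantitative. There is a
functional `S₁`, a nonnegative combination of polymatroid inequalities tight on `Φ₁`, that dominates
the total rank of every subspace arrangement on `X₁` over a field with `2 ≠ 0`; likewise `S₂`, tight
on `Φ₂`, for fields with `2 = 0`.

Consider `h(X) + (S₁(h) - h(X₁)) + (S₂(h) - h(X₂))`, with `S₁`, `S₂` evaluated on restrictions. Over
any field one bracket is nonnegative, and the other is at least `-h(X)` by monotonicity, so the sum
is nonnegative on representable `h`. The perturbation leaves both restrictions equal to `Φ₁` and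
`Φ₂`, where `S₁` and `S₂` vanish, but lowers the rank of `X` by `ε`, so the value drops to `-ε`. The
perturbation is still Ingletonian, because Ingleton's inequality passes to direct sums and to
truncations (`IsIngletonian.truncate`).

The quantitative bounds (`ApproxConfig.dim_le_of_fano`, `ApproxConfig.dim_le_of_nonFano`) repeat the
usual coordinate argument with linear maps in place of vectors and equality up to a map of small
rank in place of equality: the inclusion of `r` splits as `x + y + z`, and the remaining relations
force `2z`, respectively `P ≈ x + y`, to have small rank. -/

noncomputable section

namespace Polymat

/-! ### Subspace arrangements and Ingleton's inequality -/

section Subspaces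

variable {F W X : Type*} [Field F] [AddCommGroup W] [Module F W]

/-- The dimension of a subspace, as a real number. -/
def dim (A : Submodule F W) : ℝ := (Module.finrank F A : ℝ)

/-- The subspace spanned by the members of a family indexed by a finite set. -/
def spanOf (V : X → Submodule F W) (A : Finset X) : Submodule F W := ⨆ i ∈ A, V i

theorem spanOf_empty (V : X → Submodule F W) : spanOf V ∅ = ⊥ := by simp [spanOf]

theorem spanOf_singleton (V : X → Submodule F W) (x : X) : spanOf V {x} = V x := by
  simp [spanOf]

theorem spanOf_insert [DecidableEq X] (V : X → Submodule F W) (x : X) (A : Finset X) :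
    spanOf V (insert x A) = V x ⊔ spanOf V A :=
  Finset.iSup_insert _ _ _

theorem spanOf_union [DecidableEq X] (V : X → Submodule F W) (A B : Finset X) :
    spanOf V (A ∪ B) = spanOf V A ⊔ spanOf V B :=
  Finset.iSup_union

theorem spanOf_mono (V : X → Submodule F W) {A B : Finset X} (h : A ⊆ B) :
    spanOf V A ≤ spanOf V B :=
  biSup_mono h

/-- The ambient space of `Φ₁` and `Φ₂` is not assumed finite-dimensional; finite-dimensional members
suffice for the dimension formulas. -/
instance spanOf_finiteDimensional (V : X → Submodule F W) [∀ i, FiniteDimensional F (V i)]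
    (A : Finset X) : FiniteDimensional F (spanOf V A) := by
  classical
  induction A using Finset.induction_on with
  | empty => rw [spanOf_empty]; infer_instance
  | insert x A _ ih => rw [spanOf_insert]; infer_instance

theorem subspaceRank_eq (V : X → Submodule F W) (A : Finset X) :
    subspaceRank F V A = dim (spanOf V A) := rfl

theorem dim_sup_add_inf (A B : Submodule F W) [FiniteDimensional F A]
    [FiniteDimensional F B] :
    dim (A ⊔ B) + dim (A ⊓ B)
      = dim A + dim B := by
  unfold dim
  exact_mod_cast Submodule.finrank_sup_add_finrank_inf_eq A B

theorem dim_le_of_le {A B : Submodule F W} [FiniteDimensional F B] (h : A ≤ B) :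
    dim A ≤ dim B := by
  unfold dim
  exact_mod_cast Submodule.finrank_mono h

/-- Ingleton's inequality for four subspaces. -/
theorem ingleton_subspaces (A B C D : Submodule F W) [FiniteDimensional F A]
    [FiniteDimensional F B] [FiniteDimensional F C] [FiniteDimensional F D] :
    dim A + dim B + dim (C ⊔ D)
        + dim (A ⊔ B ⊔ C)
        + dim (A ⊔ B ⊔ D)
      ≤ dim (A ⊔ B) + dim (A ⊔ C)
        + dim (A ⊔ D) + dim (B ⊔ C)
        + dim (B ⊔ D) := by
  have hAB := dim_sup_add_inf A B
  -- The subspace `A ⊓ B` realises the common information of `A` and `B`. It lies in both, which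
  -- gives `key`; applying `key` to `C` and `D`, then submodularity over `A ⊓ B`, yields Ingleton.
  have key : ∀ E : Submodule F W, FiniteDimensional F E →
      dim (A ⊔ B ⊔ E)
        + dim ((A ⊓ B) ⊔ E)
        ≤ dim (A ⊔ E)
          + dim (B ⊔ E) := by
    intro E _
    have h := dim_sup_add_inf (A ⊔ E) (B ⊔ E)
    rw [← sup_sup_distrib_right] at h
    have h' : dim ((A ⊓ B) ⊔ E)
        ≤ dim ((A ⊔ E) ⊓ (B ⊔ E)) :=
      dim_le_of_le (le_inf (sup_le_sup_right inf_le_left _) (sup_le_sup_right inf_le_right _))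
    linarith
  have hC := key C inferInstance
  have hD := key D inferInstance
  have hN := dim_sup_add_inf ((A ⊓ B) ⊔ C) ((A ⊓ B) ⊔ D)
  have h1 : dim (A ⊓ B)
      ≤ dim (((A ⊓ B) ⊔ C) ⊓ ((A ⊓ B) ⊔ D)) :=
    dim_le_of_le (le_inf le_sup_left le_sup_left)
  have h2 : dim (C ⊔ D)
      ≤ dim (((A ⊓ B) ⊔ C) ⊔ ((A ⊓ B) ⊔ D)) :=
    dim_le_of_le (sup_le_sup le_sup_right le_sup_right)
  linarith

theorem isPolymatroid_subspaceRank [DecidableEq X] (V : X → Submodule F W)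
    [∀ i, FiniteDimensional F (V i)] :
    IsPolymatroid (subspaceRank F V) where
  nonneg A := Nat.cast_nonneg _
  empty := by simp [subspaceRank_eq, spanOf_empty, dim]
  mono A B h := by
    simpa only [subspaceRank_eq] using dim_le_of_le (spanOf_mono V h)
  submodular A B := by
    simp only [subspaceRank_eq, spanOf_union]
    have h := dim_sup_add_inf (spanOf V A) (spanOf V B)
    have h' : dim (spanOf V (A ∩ B))
        ≤ dim (spanOf V A ⊓ spanOf V B) :=
      dim_le_of_le (le_inf (spanOf_mono V Finset.inter_subset_left)
        (spanOf_mono V Finset.inter_subset_right))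
    linarith

theorem isIngletonian_subspaceRank [DecidableEq X] (V : X → Submodule F W)
    [∀ i, FiniteDimensional F (V i)] :
    IsIngletonian (subspaceRank F V) where
  isPolymatroid := isPolymatroid_subspaceRank V
  ingleton_nonneg A B C D := by
    have h := ingleton_subspaces (spanOf V A) (spanOf V B) (spanOf V C) (spanOf V D)
    simp only [ingleton, subspaceRank_eq, spanOf_union]
    linarith

end Subspaces

/-! ### Direct sums and truncations -/

section Operations

theorem IsPolymatroid.directSum {X₁ X₂ : Type*} [DecidableEq X₁] [DecidableEq X₂]
    {h₁ : RankFun X₁} {h₂ : RankFun X₂} (H₁ : IsPolymatroid h₁) (H₂ : IsPolymatroid h₂) :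
    IsPolymatroid (directSum h₁ h₂) where
  nonneg A := add_nonneg (H₁.nonneg _) (H₂.nonneg _)
  empty := by
    have h1 : (∅ : Finset (X₁ ⊕ X₂)).toLeft = ∅ := by ext; simp
    have h2 : (∅ : Finset (X₁ ⊕ X₂)).toRight = ∅ := by ext; simp
    simp [Polymat.directSum, h1, h2, H₁.empty, H₂.empty]
  mono A B h := add_le_add (H₁.mono _ _ (Finset.toLeft_subset_toLeft h))
    (H₂.mono _ _ (Finset.toRight_subset_toRight h))
  submodular A B := by
    have h1 := H₁.submodular A.toLeft B.toLeft
    have h2 := H₂.submodular A.toRight B.toRight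
    simp only [Polymat.directSum, Finset.toLeft_union, Finset.toRight_union,
      Finset.toLeft_inter, Finset.toRight_inter]
    linarith

theorem IsIngletonian.directSum {X₁ X₂ : Type*} [DecidableEq X₁] [DecidableEq X₂]
    {h₁ : RankFun X₁} {h₂ : RankFun X₂} (H₁ : IsIngletonian h₁) (H₂ : IsIngletonian h₂) :
    IsIngletonian (directSum h₁ h₂) where
  isPolymatroid := H₁.isPolymatroid.directSum H₂.isPolymatroid
  ingleton_nonneg A B C D := by
    have h1 := H₁.ingleton_nonneg A.toLeft B.toLeft C.toLeft D.toLeft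
    have h2 := H₂.ingleton_nonneg A.toRight B.toRight C.toRight D.toRight
    simp only [ingleton, Polymat.directSum, Finset.toLeft_union, Finset.toRight_union] at *
    linarith

/-- Truncating a polymatroid at a nonnegative level gives a polymatroid. -/
theorem IsPolymatroid.truncate {X : Type*} [DecidableEq X] {h : RankFun X}
    (H : IsPolymatroid h) {t : ℝ} (ht : 0 ≤ t) : IsPolymatroid fun A => min (h A) t where
  nonneg A := le_min (H.nonneg A) ht
  empty := by simp [H.empty, ht]
  mono A B hAB := min_le_min_right _ (H.mono A B hAB)
  submodular A B := by
    have h0 := H.submodular A B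
    have h3 := H.mono _ _ (Finset.inter_subset_left (s₁ := A) (s₂ := B))
    have h4 := H.mono _ _ (Finset.inter_subset_right (s₁ := A) (s₂ := B))
    rcases le_total (h A) t with hA | hA
    · rcases le_total (h B) t with hB | hB
      · rw [min_eq_left hA, min_eq_left hB]
        linarith [min_le_left (h (A ∪ B)) t, min_le_left (h (A ∩ B)) t]
      · rw [min_eq_left hA, min_eq_right hB]
        linarith [min_le_right (h (A ∪ B)) t, min_le_left (h (A ∩ B)) t]
    · rw [min_eq_right hA]
      have := min_le_min_right t h4
      linarith [min_le_right (h (A ∪ B)) t]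

/-- Submodularity for two sets with a common part. -/
theorem IsPolymatroid.union_union_add_le {X : Type*} [DecidableEq X] {h : RankFun X}
    (H : IsPolymatroid h) (A B C : Finset X) :
    h A + h (A ∪ B ∪ C) ≤ h (A ∪ B) + h (A ∪ C) := by
  have h0 := H.submodular (A ∪ B) (A ∪ C)
  have h1 := H.mono A ((A ∪ B) ∩ (A ∪ C))
    (Finset.subset_inter Finset.subset_union_left Finset.subset_union_left)
  have h2 : A ∪ B ∪ (A ∪ C) = A ∪ B ∪ C := by
    ext; simp; tauto
  rw [h2] at h0
  linarith

/-- Truncation preserves Ingleton's inequalities. -/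
theorem IsIngletonian.truncate {X : Type*} [DecidableEq X] {h : RankFun X}
    (H : IsIngletonian h) {t : ℝ} (ht : 0 ≤ t) : IsIngletonian fun A => min (h A) t where
  isPolymatroid := H.isPolymatroid.truncate ht
  ingleton_nonneg A B C D := by
    have P := H.isPolymatroid.truncate ht
    have I := H.ingleton_nonneg A B C D
    set g : RankFun X := fun A => min (h A) t with hg
    have cap : ∀ E, g E ≤ t := fun E => min_le_right _ _
    have low : ∀ E, g E ≤ h E := fun E => min_le_left _ _
    have val : ∀ E, g E = h E ∨ g E = t := fun E => min_choice _ _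
    have sA := P.union_union_add_le A C D
    have sB := P.union_union_add_le B C D
    have sAC := P.union_union_add_le A B C
    have sAD := P.union_union_add_le A B D
    have sBC := P.union_union_add_le B A C
    have sBD := P.union_union_add_le B A D
    rw [Finset.union_comm B A] at sBC sBD
    have sCD := P.union_union_add_le (C ∪ D) A B
    have eA : C ∪ D ∪ A = A ∪ C ∪ D := by ext; simp; tauto
    have eB : C ∪ D ∪ B = B ∪ C ∪ D := by ext; simp; tauto
    have eAB : C ∪ D ∪ A ∪ B = A ∪ B ∪ (C ∪ D) := by ext; simp; tauto
    rw [eAB, eA, eB] at sCD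
    have mA := P.mono (C ∪ D) (A ∪ C ∪ D) (by rw [← eA]; exact Finset.subset_union_left)
    have mB := P.mono (C ∪ D) (B ∪ C ∪ D) (by rw [← eB]; exact Finset.subset_union_left)
    have m1 := P.mono (A ∪ B) (A ∪ B ∪ (C ∪ D)) Finset.subset_union_left
    have c1 := cap (A ∪ B ∪ C)
    have c2 := cap (A ∪ B ∪ D)
    simp only [ingleton] at I ⊢
    -- If no positive term is truncated, Ingleton for `h` suffices, since the negative terms only
    -- decrease. If a positive term equals `t`, it pays for one of the two triple unions, and
    -- submodularity and monotonicity of `g` cover the rest.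
    rcases val (A ∪ B) with h12 | h12
    · rcases val (A ∪ C) with h13 | h13
      · rcases val (A ∪ D) with h14 | h14
        · rcases val (B ∪ C) with h23 | h23
          · rcases val (B ∪ D) with h24 | h24
            · linarith [low A, low B, low (C ∪ D), low (A ∪ B ∪ C), low (A ∪ B ∪ D)]
            · linarith
          · linarith
        · linarith
      · linarith
    · linarith

theorem IsIngletonian.perturb {X : Type*} [Fintype X] [DecidableEq X] {h : RankFun X}
    (H : IsIngletonian h) {ε : ℝ} (hε : ε ≤ h Finset.univ) : IsIngletonian (perturb ε h) :=
  H.truncate (sub_nonneg.2 hε)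

end Operations

/-! ### Linear maps up to small rank -/

section RankApproximation

variable {F U W : Type*} [Field F] [AddCommGroup U] [Module F U] [AddCommGroup W] [Module F W]

/-- The rank of a linear map, as a real number. -/
def rk (f : U →ₗ[F] W) : ℝ := dim (LinearMap.range f)

theorem rk_neg (f : U →ₗ[F] W) : rk (-f) = rk f := by
  rw [rk, rk, LinearMap.range_neg]

theorem rk_smul {k : F} (hk : k ≠ 0) (f : U →ₗ[F] W) : rk (k • f) = rk f := by
  rw [rk, rk, LinearMap.range_smul f k hk]

theorem range_add_le_of_le {f g : U →ₗ[F] W} {A : Submodule F W} (hf : LinearMap.range f ≤ A)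
    (hg : LinearMap.range g ≤ A) : LinearMap.range (f + g) ≤ A := by
  rintro _ ⟨x, rfl⟩
  exact A.add_mem (hf ⟨x, rfl⟩) (hg ⟨x, rfl⟩)

theorem range_neg_le_of_le {f : U →ₗ[F] W} {A : Submodule F W} (hf : LinearMap.range f ≤ A) :
    LinearMap.range (-f) ≤ A := by
  rwa [LinearMap.range_neg]

theorem range_sub_le_of_le {f g : U →ₗ[F] W} {A : Submodule F W} (hf : LinearMap.range f ≤ A)
    (hg : LinearMap.range g ≤ A) : LinearMap.range (f - g) ≤ A := by
  rw [sub_eq_add_neg]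
  exact range_add_le_of_le hf (range_neg_le_of_le hg)

/-- `B × C` surjects onto `B ⊔ C`, and `f` lifts through this surjection because vector spaces are
projective. -/
theorem exists_add_of_range_le_sup {f : U →ₗ[F] W} {B C : Submodule F W}
    (hf : LinearMap.range f ≤ B ⊔ C) :
    ∃ g k : U →ₗ[F] W, LinearMap.range g ≤ B ∧ LinearMap.range k ≤ C ∧ f = g + k := by
  have hr : LinearMap.range (B.subtype.coprod C.subtype) = B ⊔ C := by
    simp [LinearMap.range_coprod]
  obtain ⟨l, hl⟩ := Module.projective_lifting_property
    (B.subtype.coprod C.subtype).rangeRestrict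
    (f.codRestrict (LinearMap.range (B.subtype.coprod C.subtype))
      fun x => by rw [hr]; exact hf ⟨x, rfl⟩)
    (LinearMap.surjective_rangeRestrict _)
  refine ⟨B.subtype ∘ₗ LinearMap.fst F B C ∘ₗ l, C.subtype ∘ₗ LinearMap.snd F B C ∘ₗ l,
    ?_, ?_, ?_⟩
  · rintro _ ⟨x, rfl⟩
    exact (l x).1.2
  · rintro _ ⟨x, rfl⟩
    exact (l x).2.2
  · ext x
    have := congrArg Subtype.val (LinearMap.congr_fun hl x)
    simpa using this.symm

variable [FiniteDimensional F W]

theorem rk_le_of_range_le {f : U →ₗ[F] W} {A : Submodule F W} (h : LinearMap.range f ≤ A) :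
    rk f ≤ dim A :=
  dim_le_of_le h

theorem dim_sup_le (A B : Submodule F W) :
    dim (A ⊔ B) ≤ dim A + dim B := by
  unfold dim
  exact_mod_cast Submodule.finrank_add_le_finrank_add_finrank A B

theorem rk_add_le {f g : U →ₗ[F] W} {k l : ℝ} (hf : rk f ≤ k) (hg : rk g ≤ l) :
    rk (f + g) ≤ k + l := by
  have h : LinearMap.range (f + g) ≤ LinearMap.range f ⊔ LinearMap.range g := by
    rintro _ ⟨x, rfl⟩
    exact Submodule.add_mem_sup ⟨x, rfl⟩ ⟨x, rfl⟩
  have h' := rk_le_of_range_le h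
  have := dim_sup_le (LinearMap.range f) (LinearMap.range g)
  unfold rk at *
  linarith

theorem rk_sub_le {f g : U →ₗ[F] W} {k l : ℝ} (hf : rk f ≤ k) (hg : rk g ≤ l) :
    rk (f - g) ≤ k + l := by
  rw [sub_eq_add_neg]
  exact rk_add_le hf (by rwa [rk_neg])

/-- By the dimension formula, enlarging `B` by `E` raises `dim B` by at most `dim E` and cannot
lower the dimension of the sum with `A`. -/
theorem dim_inf_sup_le (A B E : Submodule F W) :
    dim (A ⊓ (B ⊔ E))
      ≤ dim (A ⊓ B) + dim E := by
  have h1 := dim_sup_add_inf A (B ⊔ E)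
  have h2 := dim_sup_add_inf A B
  have h3 := dim_sup_le B E
  have h4 : dim (A ⊔ B)
      ≤ dim (A ⊔ (B ⊔ E)) :=
    dim_le_of_le (sup_le_sup_left le_sup_left _)
  linarith

/-- A map into `A` that is close to a map into `B` is small when `A ⊓ B` is small. -/
theorem rk_le_of_rk_sub_le {f g : U →ₗ[F] W} {A B : Submodule F W} {k S : ℝ}
    (hf : LinearMap.range f ≤ A) (hg : LinearMap.range g ≤ B)
    (hAB : dim (A ⊓ B) ≤ S) (hk : rk (f - g) ≤ k) :
    rk f ≤ k + S := by
  have h : LinearMap.range f ≤ A ⊓ (B ⊔ LinearMap.range (f - g)) := by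
    refine le_inf hf ?_
    rintro _ ⟨x, rfl⟩
    have : f x = g x + (f - g) x := by simp
    rw [this]
    exact Submodule.add_mem_sup (hg ⟨x, rfl⟩) ⟨x, rfl⟩
  have h1 := rk_le_of_range_le h
  have h2 := dim_inf_sup_le A B (LinearMap.range (f - g))
  unfold rk at *
  linarith

/-- A map into `A` is close to a map into `B` when `A` is almost contained in `B`. -/
theorem exists_range_le_of_almost_le {f : U →ₗ[F] W} {A B : Submodule F W} {S : ℝ}
    (hf : LinearMap.range f ≤ A)
    (hAB : dim (A ⊔ B) ≤ dim B + S) :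
    ∃ g : U →ₗ[F] W, LinearMap.range g ≤ B ∧ rk (f - g) ≤ S := by
  obtain ⟨π, hπ⟩ := LinearMap.exists_leftInverse_of_injective B.subtype
    (LinearMap.ker_eq_bot.2 B.subtype_injective)
  have hπ' : ∀ b ∈ B, (π b : W) = b := fun b hb =>
    congrArg Subtype.val (LinearMap.congr_fun hπ ⟨b, hb⟩)
  refine ⟨B.subtype ∘ₗ π ∘ₗ f, ?_, ?_⟩
  · rintro _ ⟨x, rfl⟩
    exact (π (f x)).2
  -- The error is `e ∘ f` with `e = 1 - π`. Since `e` kills `B`, its rank on `A ⊔ B` is at most `dim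
  -- (A ⊔ B) - dim B ≤ S`.
  · set e : W →ₗ[F] W := LinearMap.id - B.subtype ∘ₗ π with he
    set e' := e.domRestrict (A ⊔ B) with he'
    have hker : B.comap (A ⊔ B).subtype ≤ LinearMap.ker e' := by
      rintro ⟨x, hx⟩ hxB
      have hxB : x ∈ B := hxB
      simp [he', he, hπ' x hxB]
    have h1 := LinearMap.finrank_range_add_finrank_ker e'
    have h2 := Submodule.finrank_mono hker
    rw [(Submodule.comapSubtypeEquivOfLe (le_sup_right : B ≤ A ⊔ B)).finrank_eq] at h2
    have h3 : LinearMap.range (f - B.subtype ∘ₗ π ∘ₗ f) ≤ LinearMap.range e' := by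
      rintro _ ⟨x, rfl⟩
      exact ⟨⟨f x, Submodule.mem_sup_left (hf ⟨x, rfl⟩)⟩, by simp [he', he]⟩
    have h4 := rk_le_of_range_le h3
    have h5 : dim (LinearMap.range e') + dim B
        ≤ dim (A ⊔ B) := by
      unfold dim
      norm_cast
      omega
    linarith

theorem exists_add_of_almost_le_sup {f : U →ₗ[F] W} {A B C : Submodule F W} {S : ℝ}
    (hf : LinearMap.range f ≤ A)
    (hA : dim (A ⊔ (B ⊔ C))
      ≤ dim (B ⊔ C) + S) :
    ∃ g k : U →ₗ[F] W, LinearMap.range g ≤ B ∧ LinearMap.range k ≤ C ∧ rk (f - g - k) ≤ S := by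
  obtain ⟨m, hm, hfm⟩ := exists_range_le_of_almost_le hf hA
  obtain ⟨g, k, hg, hk, rfl⟩ := exists_add_of_range_le_sup hm
  exact ⟨g, k, hg, hk, by rwa [sub_sub]⟩

/-- If `r ≈ x + y + z` with `x, y, z` in independent subspaces `a, b, c`, if `p` is almost in
`a ⊔ b` and `r` almost in `c ⊔ p`, then `x + y` is close to a map into `p`. -/
theorem exists_close_to_partial_sum {f x y z : U →ₗ[F] W} {a b c p r : Submodule F W} {S : ℝ}
    (hf : LinearMap.range f ≤ r) (hx : LinearMap.range x ≤ a) (hy : LinearMap.range y ≤ b)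
    (hz : LinearMap.range z ≤ c) (hs : rk (f - (x + y + z)) ≤ S)
    (hr : dim (r ⊔ (c ⊔ p))
      ≤ dim (c ⊔ p) + S)
    (hp : dim (p ⊔ (a ⊔ b))
      ≤ dim (a ⊔ b) + S)
    (hc : dim (c ⊓ (a ⊔ b)) ≤ S) :
    ∃ w : U →ₗ[F] W, LinearMap.range w ≤ p ∧ rk (w - (x + y)) ≤ 6 * S := by
  obtain ⟨z', w, hz', hw, hzw⟩ := exists_add_of_almost_le_sup hf hr
  obtain ⟨m, hm, hwm⟩ := exists_range_le_of_almost_le hw hp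
  -- Two approximate decompositions of `f` are compared: `z - z'` maps into `c` and is within `3S`
  -- of a map into `a ⊔ b`, so almost independence makes its rank at most `4S`. Then `6 = 1 + 1 +
  -- 4`.
  have h1 : rk (z - z' - (m - (x + y))) ≤ S + S + S := by
    have := rk_add_le (rk_sub_le hzw hs) hwm
    rwa [show f - z' - w - (f - (x + y + z)) + (w - m) = z - z' - (m - (x + y)) by abel] at this
  have h2 := rk_le_of_rk_sub_le (range_sub_le_of_le hz hz')
    (range_sub_le_of_le hm (range_add_le_of_le (hx.trans le_sup_left) (hy.trans le_sup_right)))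
    hc h1
  refine ⟨w, hw, ?_⟩
  have := rk_add_le (rk_sub_le hs hzw) h2
  rw [show f - (x + y + z) - (f - z' - w) + (z - z') = w - (x + y) by abel] at this
  linarith

/-- Subspaces which approximately form a configuration `a, b, c, p = a + b, q = b + c,
r = a + b + c, s = a + c`, with error at most `S`. -/
structure ApproxConfig (a b c p q r s : Submodule F W) (S : ℝ) : Prop where
  r_abc : dim (r ⊔ (a ⊔ (b ⊔ c)))
    ≤ dim (a ⊔ (b ⊔ c)) + S
  r_cp : dim (r ⊔ (c ⊔ p))
    ≤ dim (c ⊔ p) + S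
  r_aq : dim (r ⊔ (a ⊔ q))
    ≤ dim (a ⊔ q) + S
  r_bs : dim (r ⊔ (b ⊔ s))
    ≤ dim (b ⊔ s) + S
  p_ab : dim (p ⊔ (a ⊔ b))
    ≤ dim (a ⊔ b) + S
  q_bc : dim (q ⊔ (b ⊔ c))
    ≤ dim (b ⊔ c) + S
  s_ac : dim (s ⊔ (a ⊔ c))
    ≤ dim (a ⊔ c) + S
  c_ab : dim (c ⊓ (a ⊔ b)) ≤ S
  a_bc : dim (a ⊓ (b ⊔ c)) ≤ S
  b_ac : dim (b ⊓ (a ⊔ c)) ≤ S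

variable {a b c p q r s : Submodule F W} {S : ℝ}

/-- Coordinates of a generic point of `r`: the domain is `r` itself, so the rank of the inclusion is
`dim r`. The approximate relations among `r, c, p`, among `r, a, q` and among `r, b, s` let the
partial sums be realised in `p`, `q` and `s`. -/
theorem ApproxConfig.exists_maps (H : ApproxConfig a b c p q r s S) :
    ∃ x y z P Q T : r →ₗ[F] W, LinearMap.range x ≤ a ∧ LinearMap.range y ≤ b ∧
      LinearMap.range z ≤ c ∧ LinearMap.range P ≤ p ∧ LinearMap.range Q ≤ q ∧
      LinearMap.range T ≤ s ∧ rk (r.subtype - (x + y + z)) ≤ S ∧ rk (P - (x + y)) ≤ 6 * S ∧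
      rk (Q - (y + z)) ≤ 6 * S ∧ rk (T - (x + z)) ≤ 6 * S := by
  have hι : LinearMap.range r.subtype ≤ r := (Submodule.range_subtype r).le
  obtain ⟨x, m, hx, hm, hxm⟩ := exists_add_of_almost_le_sup hι H.r_abc
  obtain ⟨y, z, hy, hz, rfl⟩ := exists_add_of_range_le_sup hm
  have h0 : rk (r.subtype - (x + y + z)) ≤ S := by
    rwa [show r.subtype - (x + y + z) = r.subtype - x - (y + z) by abel]
  obtain ⟨P, hP, hP'⟩ := exists_close_to_partial_sum hι hx hy hz h0 H.r_cp H.p_ab H.c_ab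
  obtain ⟨Q, hQ, hQ'⟩ := exists_close_to_partial_sum hι hy hz hx
    (by rwa [show y + z + x = x + y + z by abel]) H.r_aq H.q_bc H.a_bc
  obtain ⟨T, hT, hT'⟩ := exists_close_to_partial_sum hι hx hz hy
    (by rwa [show x + z + y = x + y + z by abel]) H.r_bs H.s_ac H.b_ac
  exact ⟨x, y, z, P, Q, T, hx, hy, hz, hP, hQ, hT, h0, hP', hQ', hT'⟩

/-- Away from characteristic two, an approximate Fano configuration is small. -/
theorem ApproxConfig.dim_le_of_fano (H : ApproxConfig a b c p q r s S) (h2 : (2 : F) ≠ 0)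
    (p_qs : dim (p ⊔ (q ⊔ s))
      ≤ dim (q ⊔ s) + S)
    (c_s : dim (c ⊓ s) ≤ S)
    (c_q : dim (c ⊓ q) ≤ S)
    (b_q : dim (b ⊓ q) ≤ S)
    (a_s : dim (a ⊓ s) ≤ S) :
    dim r ≤ 153 * S := by
  obtain ⟨x, y, z, P, Q, T, hx, hy, hz, hP, hQ, hT, h0, hP', hQ', hT'⟩ := H.exists_maps
  -- The Fano relation writes `P ≈ x + y` through `q` and `s`, hence as `α + β + γ + δ`. Comparing
  -- components in `a`, `b`, `c` gives `α ≈ x`, `β ≈ y` and `γ + δ ≈ 0`.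
  obtain ⟨Q₁, T₁, hQ₁, hT₁, hPQT⟩ := exists_add_of_almost_le_sup hP p_qs
  obtain ⟨β, γ, hβ, hγ, hβγ⟩ := exists_add_of_almost_le_sup hQ₁ H.q_bc
  obtain ⟨α, δ, hα, hδ, hαδ⟩ := exists_add_of_almost_le_sup hT₁ H.s_ac
  have e : rk ((x + y) - (α + β + γ + δ)) ≤ 6 * S + S + S + S := by
    have := rk_add_le (rk_add_le (rk_add_le ((rk_neg _).le.trans hP') hPQT) hβγ) hαδ
    rwa [show -(P - (x + y)) + (P - Q₁ - T₁) + (Q₁ - β - γ) + (T₁ - α - δ)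
      = x + y - (α + β + γ + δ) by abel] at this
  have eα : rk (α - x) ≤ 6 * S + S + S + S + S := by
    refine rk_le_of_rk_sub_le (g := y - β - (γ + δ)) (range_sub_le_of_le hα hx)
      (range_sub_le_of_le ((range_sub_le_of_le hy hβ).trans le_sup_left)
        ((range_add_le_of_le hγ hδ).trans le_sup_right)) H.a_bc ?_
    rw [← rk_neg]
    rwa [show -(α - x - (y - β - (γ + δ))) = x + y - (α + β + γ + δ) by abel]
  have eβ : rk (β - y) ≤ 6 * S + S + S + S + S := by
    refine rk_le_of_rk_sub_le (g := x - α - (γ + δ)) (range_sub_le_of_le hβ hy)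
      (range_sub_le_of_le ((range_sub_le_of_le hx hα).trans le_sup_left)
        ((range_add_le_of_le hγ hδ).trans le_sup_right)) H.b_ac ?_
    rw [← rk_neg]
    rwa [show -(β - y - (x - α - (γ + δ))) = x + y - (α + β + γ + δ) by abel]
  have eγδ : rk (γ + δ) ≤ 6 * S + S + S + S + S := by
    refine rk_le_of_rk_sub_le (g := (x - α) + (y - β)) (range_add_le_of_le hγ hδ)
      (range_add_le_of_le ((range_sub_le_of_le hx hα).trans le_sup_left)
        ((range_sub_le_of_le hy hβ).trans le_sup_right)) H.c_ab ?_
    rw [← rk_neg]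
    rwa [show -(γ + δ - (x - α + (y - β))) = x + y - (α + β + γ + δ) by abel]
  -- `Q₁ ≈ y + γ` and `Q ≈ y + z` both map into `q`, so `γ - z` is close to a map into `q`, which is
  -- almost independent of `c`. The same argument with `s` gives `δ ≈ z`.
  have eγ : rk (γ - z) ≤ S + 6 * S + (6 * S + S + S + S + S) + S := by
    refine rk_le_of_rk_sub_le (g := Q₁ - Q) (range_sub_le_of_le hγ hz)
      (range_sub_le_of_le hQ₁ hQ) c_q ?_
    rw [← rk_neg]
    have := rk_add_le (rk_sub_le hβγ hQ') eβ
    rwa [show Q₁ - β - γ - (Q - (y + z)) + (β - y) = -(γ - z - (Q₁ - Q)) by abel] at this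
  have eδ : rk (δ - z) ≤ S + 6 * S + (6 * S + S + S + S + S) + S := by
    refine rk_le_of_rk_sub_le (g := T₁ - T) (range_sub_le_of_le hδ hz)
      (range_sub_le_of_le hT₁ hT) c_s ?_
    rw [← rk_neg]
    have := rk_add_le (rk_sub_le hαδ hT') eα
    rwa [show T₁ - α - δ - (T - (x + z)) + (α - x) = -(δ - z - (T₁ - T)) by abel] at this
  -- Now `2z ≈ γ + δ ≈ 0`, with `46 = 10 + 18 + 18`; scaling by the nonzero `2` preserves rank.
  have ez : rk z ≤ 46 * S := by
    have := rk_sub_le (rk_sub_le eγδ eγ) eδ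
    rw [show γ + δ - (γ - z) - (δ - z) = (2 : F) • z by rw [two_smul]; abel, rk_smul h2] at this
    linarith
  have ey : rk y ≤ 46 * S + 6 * S + S := by
    refine rk_le_of_rk_sub_le (g := Q) hy hQ b_q ?_
    rw [← rk_neg]
    have := rk_add_le ez hQ'
    rwa [show z + (Q - (y + z)) = -(y - Q) by abel] at this
  have ex : rk x ≤ 46 * S + 6 * S + S := by
    refine rk_le_of_rk_sub_le (g := T) hx hT a_s ?_
    rw [← rk_neg]
    have := rk_add_le ez hT'
    rwa [show z + (T - (x + z)) = -(x - T) by abel] at this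
  -- The total is `153 = 1 + 53 + 53 + 46`.
  have := rk_add_le h0 (rk_add_le (rk_add_le ex ey) ez)
  rw [sub_add_cancel, rk, Submodule.range_subtype] at this
  linarith

/-- In characteristic two, an approximate non-Fano configuration is small. -/
theorem ApproxConfig.dim_le_of_nonFano (H : ApproxConfig a b c p q r s S) (h2 : (2 : F) = 0)
    (p_qs : dim (p ⊓ (q ⊔ s)) ≤ S)
    (r_c : dim (r ⊓ c) ≤ S) :
    dim r ≤ 27 * S := by
  obtain ⟨x, y, z, P, Q, T, hx, hy, hz, hP, hQ, hT, h0, hP', hQ', hT'⟩ := H.exists_maps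
  -- `P + Q + T ≈ 2(x + y + z) = 0`, so `P` is close to a map into `q ⊔ s`, from which `p` is almost
  -- independent. With `x + y ≈ P ≈ 0`, the inclusion of `r` is then close to `z`, a map into `c`.
  have eP : rk P ≤ 6 * S + 6 * S + 6 * S + S := by
    refine rk_le_of_rk_sub_le (g := -(Q + T)) hP (range_neg_le_of_le
      (range_add_le_of_le (hQ.trans le_sup_left) (hT.trans le_sup_right))) p_qs ?_
    have := rk_add_le (rk_add_le hP' hQ') hT'
    rwa [show P - (x + y) + (Q - (y + z)) + (T - (x + z))
      = P - -(Q + T) - (2 : F) • (x + y + z) by rw [two_smul]; abel, h2, zero_smul,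
      sub_zero] at this
  have hι : LinearMap.range r.subtype ≤ r := (Submodule.range_subtype r).le
  have : rk r.subtype ≤ S + (6 * S + 6 * S + 6 * S + S) + 6 * S + S := by
    refine rk_le_of_rk_sub_le (g := z) hι hz r_c ?_
    have := rk_sub_le (rk_add_le h0 eP) hP'
    rwa [show r.subtype - (x + y + z) + P - (P - (x + y)) = r.subtype - z by abel] at this
  rw [rk, Submodule.range_subtype] at this
  linarith

end RankApproximation

/-! ### Defects of dependence and independence -/

section Slack

variable {X : Type*} [DecidableEq X]

/-- The defect of `A` being spanned by `B`. -/
def depSlack (A B : Finset X) : RankFun X →ₗ[ℝ] ℝ :=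
  LinearMap.proj (R := ℝ) (φ := fun _ : Finset X => ℝ) (A ∪ B) - LinearMap.proj B

/-- The defect of `A` and `B` being independent. -/
def indSlack (A B : Finset X) : RankFun X →ₗ[ℝ] ℝ :=
  LinearMap.proj (R := ℝ) (φ := fun _ : Finset X => ℝ) A + LinearMap.proj B
    - LinearMap.proj (A ∪ B)

theorem depSlack_apply (A B : Finset X) (h : RankFun X) : depSlack A B h = h (A ∪ B) - h B := rfl

theorem indSlack_apply (A B : Finset X) (h : RankFun X) :
    indSlack A B h = h A + h B - h (A ∪ B) := rfl

theorem IsPolymatroid.depSlack_nonneg {h : RankFun X} (H : IsPolymatroid h) (A B : Finset X) :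
    0 ≤ depSlack A B h :=
  sub_nonneg.2 (H.mono _ _ Finset.subset_union_right)

theorem IsPolymatroid.indSlack_nonneg {h : RankFun X} (H : IsPolymatroid h) (A B : Finset X) :
    0 ≤ indSlack A B h := by
  have h1 := H.submodular A B
  have h2 := H.nonneg (A ∩ B)
  rw [indSlack_apply]
  linarith

/-- The total defect of prescribed dependencies `D` and independencies `I`. -/
def slack (D I : Finset (Finset X × Finset X)) : RankFun X →ₗ[ℝ] ℝ :=
  ∑ d ∈ D, depSlack d.1 d.2 + ∑ d ∈ I, indSlack d.1 d.2

theorem slack_apply (D I : Finset (Finset X × Finset X)) (h : RankFun X) :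
    slack D I h = ∑ d ∈ D, depSlack d.1 d.2 h + ∑ d ∈ I, indSlack d.1 d.2 h := by
  simp [slack, LinearMap.sum_apply]

theorem IsPolymatroid.slack_nonneg {h : RankFun X} (H : IsPolymatroid h)
    (D I : Finset (Finset X × Finset X)) : 0 ≤ slack D I h := by
  rw [slack_apply]
  exact add_nonneg (Finset.sum_nonneg fun _ _ => H.depSlack_nonneg _ _)
    (Finset.sum_nonneg fun _ _ => H.indSlack_nonneg _ _)

theorem IsPolymatroid.depSlack_le_slack {h : RankFun X} (H : IsPolymatroid h)
    {D I : Finset (Finset X × Finset X)} {A B : Finset X} (hd : (A, B) ∈ D) :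
    depSlack A B h ≤ slack D I h := by
  rw [slack_apply]
  have h1 := Finset.single_le_sum (f := fun d : Finset X × Finset X => depSlack d.1 d.2 h)
    (fun _ _ => H.depSlack_nonneg _ _) hd
  have h2 : 0 ≤ ∑ d ∈ I, indSlack d.1 d.2 h := Finset.sum_nonneg fun _ _ => H.indSlack_nonneg _ _
  simp only at h1
  linarith

theorem IsPolymatroid.indSlack_le_slack {h : RankFun X} (H : IsPolymatroid h)
    {D I : Finset (Finset X × Finset X)} {A B : Finset X} (hd : (A, B) ∈ I) :
    indSlack A B h ≤ slack D I h := by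
  rw [slack_apply]
  have h1 := Finset.single_le_sum (f := fun d : Finset X × Finset X => indSlack d.1 d.2 h)
    (fun _ _ => H.indSlack_nonneg _ _) hd
  have h2 : 0 ≤ ∑ d ∈ D, depSlack d.1 d.2 h := Finset.sum_nonneg fun _ _ => H.depSlack_nonneg _ _
  simp only at h1
  linarith

theorem slack_eq_zero {h : RankFun X} {D I : Finset (Finset X × Finset X)}
    (hD : ∀ d ∈ D, depSlack d.1 d.2 h = 0) (hI : ∀ d ∈ I, indSlack d.1 d.2 h = 0) :
    slack D I h = 0 := by
  rw [slack_apply, Finset.sum_eq_zero hD, Finset.sum_eq_zero hI, add_zero]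

theorem IsPolymatroid.union_le {h : RankFun X} (H : IsPolymatroid h) (A B : Finset X) :
    h (A ∪ B) ≤ h A + h B := by
  have := H.indSlack_nonneg A B
  rw [indSlack_apply] at this
  linarith

theorem IsPolymatroid.insert_le {h : RankFun X} (H : IsPolymatroid h) (x : X) (A : Finset X) :
    h (insert x A) ≤ h {x} + h A := by
  rw [Finset.insert_eq]
  exact H.union_le _ _

/-- If `a` is almost spanned by `q` and `r`, and almost independent of `q`, then its rank is at
most that of `r`, up to the errors. -/
theorem IsPolymatroid.le_add_slacks {h : RankFun X} (H : IsPolymatroid h) (a q r : X) :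
    h {a} ≤ h {r} + depSlack {a} {q, r} h + indSlack {a} {q} h := by
  have h1 := H.insert_le q {r}
  have h2 := H.mono ({a} ∪ {q}) ({a} ∪ {q, r}) (Finset.union_subset_union_right (by simp))
  rw [depSlack_apply, indSlack_apply]
  linarith

end Slack

/-! ### Defects as dimensions -/

section SubspaceSlack

variable {F W X : Type*} [Field F] [AddCommGroup W] [Module F W] [DecidableEq X]

theorem depSlack_subspaceRank (V : X → Submodule F W) (A B : Finset X) :
    depSlack A B (subspaceRank F V) = dim (spanOf V A ⊔ spanOf V B) - dim (spanOf V B) := by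
  rw [depSlack_apply, subspaceRank_eq, subspaceRank_eq, spanOf_union]

theorem indSlack_subspaceRank (V : X → Submodule F W) [∀ i, FiniteDimensional F (V i)]
    (A B : Finset X) :
    indSlack A B (subspaceRank F V) = dim (spanOf V A ⊓ spanOf V B) := by
  have := dim_sup_add_inf (spanOf V A) (spanOf V B)
  rw [indSlack_apply, subspaceRank_eq, subspaceRank_eq, subspaceRank_eq, spanOf_union]
  linarith

theorem depSlack_eq_zero {V : X → Submodule F W} {A B : Finset X}
    (h : spanOf V A ≤ spanOf V B) : depSlack A B (subspaceRank F V) = 0 := by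
  rw [depSlack_subspaceRank, sup_eq_right.2 h, sub_self]

theorem indSlack_eq_zero {V : X → Submodule F W} [∀ i, FiniteDimensional F (V i)]
    {A B : Finset X} (h : Disjoint (spanOf V A) (spanOf V B)) :
    indSlack A B (subspaceRank F V) = 0 := by
  rw [indSlack_subspaceRank, h.eq_bot]
  simp [dim]

end SubspaceSlack

/-! ### Fano and non-Fano functionals: bounds and tightness -/

section Configurations

variable {X : Type*} [DecidableEq X]

/-- Dependencies shared by the Fano and non-Fano matroids. -/
def configDeps (a b c p q r s : X) : Finset (Finset X × Finset X) :=
  {({r}, {a, b, c}), ({r}, {c, p}), ({r}, {a, q}), ({r}, {b, s}), ({p}, {a, b}), ({q}, {b, c}),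
    ({s}, {a, c}), ({a}, {q, r}), ({b}, {s, r}), ({c}, {p, r})}

/-- Independencies shared by the Fano and non-Fano matroids. -/
def configInds (a b c p q s : X) : Finset (Finset X × Finset X) :=
  {({c}, {a, b}), ({a}, {b, c}), ({b}, {a, c}), ({a}, {q}), ({b}, {s}), ({c}, {p})}

/-- Dependencies of the Fano matroid. -/
def fanoDeps (a b c p q r s : X) : Finset (Finset X × Finset X) :=
  configDeps a b c p q r s ∪ {({p}, {q, s})}

/-- Independencies of the Fano matroid. -/
def fanoInds (a b c p q s : X) : Finset (Finset X × Finset X) :=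
  configInds a b c p q s ∪ {({c}, {s}), ({c}, {q}), ({b}, {q}), ({a}, {s})}

/-- A nonnegative combination of polymatroid inequalities that are tight on the Fano matroid. -/
def fanoSlack (a b c p q r s : X) : RankFun X →ₗ[ℝ] ℝ :=
  slack (fanoDeps a b c p q r s) (fanoInds a b c p q s)

/-- A nonnegative combination of polymatroid inequalities that are tight on the non-Fano
matroid. -/
def nonFanoSlack (a b c p q r s : X) : RankFun X →ₗ[ℝ] ℝ :=
  slack (configDeps a b c p q r s) (configInds a b c p q s ∪ {({p}, {q, s}), ({r}, {c})})

section Bounds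

variable {F W : Type*} [Field F] [AddCommGroup W] [Module F W] [FiniteDimensional F W]

/-- Every summand of `slack` is nonnegative on a polymatroid, so each individual defect is bounded
by the total, which serves as a common error. -/
theorem approxConfig_of_slack (V : X → Submodule F W) {a b c p q r s : X}
    {D I : Finset (Finset X × Finset X)} (hD : configDeps a b c p q r s ⊆ D)
    (hI : configInds a b c p q s ⊆ I) :
    ApproxConfig (V a) (V b) (V c) (V p) (V q) (V r) (V s) (slack D I (subspaceRank F V)) := by
  have H := isPolymatroid_subspaceRank V
  have hd : ∀ A B, (A, B) ∈ configDeps a b c p q r s →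
      dim (spanOf V A ⊔ spanOf V B) ≤ dim (spanOf V B) + slack D I (subspaceRank F V) := by
    intro A B hAB
    have := H.depSlack_le_slack (I := I) (hD hAB)
    rw [depSlack_subspaceRank] at this
    linarith
  have hi : ∀ A B, (A, B) ∈ configInds a b c p q s →
      dim (spanOf V A ⊓ spanOf V B) ≤ slack D I (subspaceRank F V) := by
    intro A B hAB
    have := H.indSlack_le_slack (D := D) (hI hAB)
    rwa [indSlack_subspaceRank] at this
  simp only [configDeps, configInds, Finset.mem_insert, Finset.mem_singleton] at hd hi
  constructor
  · simpa [spanOf_insert, spanOf_singleton] using hd {r} {a, b, c} (by simp)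
  · simpa [spanOf_insert, spanOf_singleton] using hd {r} {c, p} (by simp)
  · simpa [spanOf_insert, spanOf_singleton] using hd {r} {a, q} (by simp)
  · simpa [spanOf_insert, spanOf_singleton] using hd {r} {b, s} (by simp)
  · simpa [spanOf_insert, spanOf_singleton] using hd {p} {a, b} (by simp)
  · simpa [spanOf_insert, spanOf_singleton] using hd {q} {b, c} (by simp)
  · simpa [spanOf_insert, spanOf_singleton] using hd {s} {a, c} (by simp)
  · simpa [spanOf_insert, spanOf_singleton] using hi {c} {a, b} (by simp)
  · simpa [spanOf_insert, spanOf_singleton] using hi {a} {b, c} (by simp)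
  · simpa [spanOf_insert, spanOf_singleton] using hi {b} {a, c} (by simp)

/-- In the model `a = r - q`, `b = r - s`, `c = r - p`. Each basis member is almost spanned by `r`
and one element almost independent of it, so a bound on `r` transfers at the cost of two defects. -/
theorem IsPolymatroid.basis_le_of_config {h : RankFun X} (H : IsPolymatroid h)
    {a b c p q r s : X} {D I : Finset (Finset X × Finset X)}
    (hD : configDeps a b c p q r s ⊆ D) (hI : configInds a b c p q s ⊆ I) :
    h {a} ≤ h {r} + 2 * slack D I h ∧ h {b} ≤ h {r} + 2 * slack D I h ∧
      h {c} ≤ h {r} + 2 * slack D I h := by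
  have d : ∀ A B, (A, B) ∈ configDeps a b c p q r s → depSlack A B h ≤ slack D I h :=
    fun A B hAB => H.depSlack_le_slack (hD hAB)
  have i : ∀ A B, (A, B) ∈ configInds a b c p q s → indSlack A B h ≤ slack D I h :=
    fun A B hAB => H.indSlack_le_slack (hI hAB)
  simp only [configDeps, configInds, Finset.mem_insert, Finset.mem_singleton] at d i
  refine ⟨?_, ?_, ?_⟩
  · linarith [H.le_add_slacks a q r, d {a} {q, r} (by simp), i {a} {q} (by simp)]
  · linarith [H.le_add_slacks b s r, d {b} {s, r} (by simp), i {b} {s} (by simp)]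
  · linarith [H.le_add_slacks c p r, d {c} {p, r} (by simp), i {c} {p} (by simp)]

/-- `155 = 153 + 2`: the bound on `r`, plus the two defects needed to pass to a basis member. -/
theorem subspaceRank_le_fanoSlack (V : X → Submodule F W) (h2 : (2 : F) ≠ 0)
    (a b c p q r s : X) :
    subspaceRank F V {a} ≤ 155 * fanoSlack a b c p q r s (subspaceRank F V) ∧
    subspaceRank F V {b} ≤ 155 * fanoSlack a b c p q r s (subspaceRank F V) ∧
    subspaceRank F V {c} ≤ 155 * fanoSlack a b c p q r s (subspaceRank F V) := by
  have H := isPolymatroid_subspaceRank V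
  have hD : configDeps a b c p q r s ⊆ fanoDeps a b c p q r s := Finset.subset_union_left
  have hI : configInds a b c p q s ⊆ fanoInds a b c p q s := Finset.subset_union_left
  obtain ⟨ha, hb, hc⟩ := H.basis_le_of_config hD hI
  have hr : subspaceRank F V {r} ≤ 153 * fanoSlack a b c p q r s (subspaceRank F V) := by
    rw [subspaceRank_eq, spanOf_singleton]
    have hi : ∀ x y, (({x} : Finset X), ({y} : Finset X)) ∈ fanoInds a b c p q s →
        dim (V x ⊓ V y) ≤ fanoSlack a b c p q r s (subspaceRank F V) := by
      intro x y hxy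
      have := H.indSlack_le_slack (D := fanoDeps a b c p q r s) hxy
      rwa [indSlack_subspaceRank, spanOf_singleton, spanOf_singleton] at this
    have hd : dim (V p ⊔ (V q ⊔ V s))
        ≤ dim (V q ⊔ V s) + fanoSlack a b c p q r s (subspaceRank F V) := by
      have hmem : (({p} : Finset X), ({q, s} : Finset X)) ∈ fanoDeps a b c p q r s :=
        Finset.mem_union_right _ (Finset.mem_singleton_self _)
      have := H.depSlack_le_slack (I := fanoInds a b c p q s) hmem
      rw [depSlack_subspaceRank, spanOf_insert, spanOf_singleton, spanOf_singleton] at this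
      unfold fanoSlack
      linarith
    have hC : ApproxConfig (V a) (V b) (V c) (V p) (V q) (V r) (V s)
        (fanoSlack a b c p q r s (subspaceRank F V)) := approxConfig_of_slack V hD hI
    exact hC.dim_le_of_fano h2 hd (hi c s (by simp [fanoInds])) (hi c q (by simp [fanoInds]))
      (hi b q (by simp [fanoInds])) (hi a s (by simp [fanoInds]))
  unfold fanoSlack at *
  refine ⟨?_, ?_, ?_⟩ <;> linarith

/-- `29 = 27 + 2`, as in the Fano case. -/
theorem subspaceRank_le_nonFanoSlack (V : X → Submodule F W) (h2 : (2 : F) = 0)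
    (a b c p q r s : X) :
    subspaceRank F V {a} ≤ 29 * nonFanoSlack a b c p q r s (subspaceRank F V) ∧
    subspaceRank F V {b} ≤ 29 * nonFanoSlack a b c p q r s (subspaceRank F V) ∧
    subspaceRank F V {c} ≤ 29 * nonFanoSlack a b c p q r s (subspaceRank F V) := by
  have H := isPolymatroid_subspaceRank V
  obtain ⟨ha, hb, hc⟩ := H.basis_le_of_config (a := a) (b := b) (c := c) (p := p) (q := q)
    (r := r) (s := s) (D := configDeps a b c p q r s)
    (I := configInds a b c p q s ∪ {({p}, {q, s}), ({r}, {c})})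
    subset_rfl Finset.subset_union_left
  have hr : subspaceRank F V {r} ≤ 27 * nonFanoSlack a b c p q r s (subspaceRank F V) := by
    rw [subspaceRank_eq, spanOf_singleton]
    have hi : ∀ A B, (A, B) ∈ configInds a b c p q s ∪ {({p}, {q, s}), ({r}, {c})} →
        dim (spanOf V A ⊓ spanOf V B) ≤ nonFanoSlack a b c p q r s (subspaceRank F V) := by
      intro A B hAB
      have := H.indSlack_le_slack (D := configDeps a b c p q r s) hAB
      rwa [indSlack_subspaceRank] at this
    have hC : ApproxConfig (V a) (V b) (V c) (V p) (V q) (V r) (V s)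
        (nonFanoSlack a b c p q r s (subspaceRank F V)) :=
      approxConfig_of_slack V subset_rfl Finset.subset_union_left
    refine hC.dim_le_of_nonFano h2 ?_ ?_
    · simpa [spanOf_insert, spanOf_singleton] using hi {p} {q, s} (by simp)
    · simpa [spanOf_insert, spanOf_singleton] using hi {r} {c} (by simp)
  unfold nonFanoSlack at *
  refine ⟨?_, ?_, ?_⟩ <;> linarith

end Bounds

section Tight

variable {F W : Type*} [Field F] [AddCommGroup W] [Module F W]

theorem span_singleton_le_sup {x y z : W} (α β : F) (h : x = α • y + β • z) :
    Submodule.span F {x} ≤ Submodule.span F {y} ⊔ Submodule.span F {z} := by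
  rw [Submodule.span_singleton_le_iff_mem, h]
  exact Submodule.add_mem_sup (Submodule.smul_mem _ _ (Submodule.mem_span_singleton_self y))
    (Submodule.smul_mem _ _ (Submodule.mem_span_singleton_self z))

theorem disjoint_span_singleton_sup {x y z : W}
    (h : ∀ α β γ : F, α • x = β • y + γ • z → α = 0) :
    Disjoint (Submodule.span F {x}) (Submodule.span F {y} ⊔ Submodule.span F {z}) := by
  rw [Submodule.disjoint_def]
  intro w hw hw'
  obtain ⟨α, rfl⟩ := Submodule.mem_span_singleton.1 hw
  obtain ⟨_, h1, _, h2, e⟩ := Submodule.mem_sup.1 hw'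
  obtain ⟨β, rfl⟩ := Submodule.mem_span_singleton.1 h1
  obtain ⟨γ, rfl⟩ := Submodule.mem_span_singleton.1 h2
  rw [h α β γ e.symm, zero_smul]

theorem disjoint_span_singletons {x y : W} (h : ∀ α β : F, α • x = β • y → α = 0) :
    Disjoint (Submodule.span F {x}) (Submodule.span F {y}) := by
  have := disjoint_span_singleton_sup (F := F) (x := x) (y := y) (z := 0)
    (fun α β γ e => h α β (by simpa using e))
  simpa using this

/-- Vectors `a, b, c, p = a + b, q = b + c, r = a + b + c, s = a + c` with `a, b, c` linearly
independent. -/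
structure ConfigVectors (F : Type*) {W X : Type*} [Field F] [AddCommGroup W] [Module F W]
    (v : X → W) (a b c p q r s : X) : Prop where
  indep : ∀ α β γ : F, α • v a + β • v b + γ • v c = 0 → α = 0 ∧ β = 0 ∧ γ = 0
  hp : v p = v a + v b
  hq : v q = v b + v c
  hr : v r = v a + v b + v c
  hs : v s = v a + v c

variable {v : X → W} {a b c p q r s : X}

theorem ConfigVectors.depSlack_eq_zero (H : ConfigVectors F v a b c p q r s) :
    ∀ d ∈ configDeps a b c p q r s,
      depSlack d.1 d.2 (subspaceRank F fun i => Submodule.span F {v i}) = 0 := by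
  obtain ⟨-, hp, hq, hr, hs⟩ := H
  simp only [configDeps, Finset.mem_insert, Finset.mem_singleton, forall_eq_or_imp, forall_eq]
  refine ⟨?_, ?_, ?_, ?_, ?_, ?_, ?_, ?_, ?_, ?_⟩ <;> apply Polymat.depSlack_eq_zero <;>
    simp only [spanOf_insert, spanOf_singleton]
  · rw [Submodule.span_singleton_le_iff_mem, hr, add_assoc]
    exact Submodule.add_mem_sup (Submodule.mem_span_singleton_self _)
      (Submodule.add_mem_sup (Submodule.mem_span_singleton_self _)
        (Submodule.mem_span_singleton_self _))
  · exact span_singleton_le_sup 1 1 (by rw [hr, hp]; module)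
  · exact span_singleton_le_sup 1 1 (by rw [hr, hq]; module)
  · exact span_singleton_le_sup 1 1 (by rw [hr, hs]; module)
  · exact span_singleton_le_sup 1 1 (by rw [hp]; module)
  · exact span_singleton_le_sup 1 1 (by rw [hq]; module)
  · exact span_singleton_le_sup 1 1 (by rw [hs]; module)
  · exact span_singleton_le_sup (-1) 1 (by rw [hr, hq]; module)
  · exact span_singleton_le_sup (-1) 1 (by rw [hr, hs]; module)
  · exact span_singleton_le_sup (-1) 1 (by rw [hr, hp]; module)

theorem ConfigVectors.indSlack_eq_zero (H : ConfigVectors F v a b c p q r s) :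
    ∀ d ∈ configInds a b c p q s,
      indSlack d.1 d.2 (subspaceRank F fun i => Submodule.span F {v i}) = 0 := by
  obtain ⟨hi, hp, hq, hr, hs⟩ := H
  simp only [configInds, Finset.mem_insert, Finset.mem_singleton, forall_eq_or_imp, forall_eq]
  refine ⟨?_, ?_, ?_, ?_, ?_, ?_⟩ <;> apply Polymat.indSlack_eq_zero <;>
    simp only [spanOf_insert, spanOf_singleton]
  · exact disjoint_span_singleton_sup fun α β γ e =>
      (hi (-β) (-γ) α (by linear_combination (norm := module) e)).2.2
  · exact disjoint_span_singleton_sup fun α β γ e =>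
      (hi α (-β) (-γ) (by linear_combination (norm := module) e)).1
  · exact disjoint_span_singleton_sup fun α β γ e =>
      (hi (-β) α (-γ) (by linear_combination (norm := module) e)).2.1
  · exact disjoint_span_singletons fun α β e =>
      (hi α (-β) (-β) (by rw [hq] at e; linear_combination (norm := module) e)).1
  · exact disjoint_span_singletons fun α β e =>
      (hi (-β) α (-β) (by rw [hs] at e; linear_combination (norm := module) e)).2.1
  · exact disjoint_span_singletons fun α β e =>
      (hi (-β) (-β) α (by rw [hp] at e; linear_combination (norm := module) e)).2.2

theorem ConfigVectors.fanoSlack_eq_zero (H : ConfigVectors F v a b c p q r s)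
    (h2 : (2 : F) = 0) :
    fanoSlack a b c p q r s (subspaceRank F fun i => Submodule.span F {v i}) = 0 := by
  refine slack_eq_zero (fun d hd => ?_) (fun d hd => ?_)
  · rcases Finset.mem_union.1 hd with hd | hd
    · exact H.depSlack_eq_zero d hd
    · obtain rfl := Finset.mem_singleton.1 hd
      apply Polymat.depSlack_eq_zero
      simp only [spanOf_insert, spanOf_singleton]
      -- `q + s = p + 2c`, and `2c = 0` in characteristic two.
      refine span_singleton_le_sup 1 1 ?_
      have : (2 : F) • v c = 0 := by rw [h2, zero_smul]
      rw [H.hp, H.hq, H.hs]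
      linear_combination (norm := module) -this
  · rcases Finset.mem_union.1 hd with hd | hd
    · exact H.indSlack_eq_zero d hd
    · obtain ⟨hi, hp, hq, hr, hs⟩ := H
      revert d
      simp only [Finset.mem_insert, Finset.mem_singleton]
      rintro d - (rfl | rfl | rfl | rfl) <;> apply Polymat.indSlack_eq_zero <;>
        simp only [spanOf_singleton]
      · exact disjoint_span_singletons fun α β e =>
          (hi (-β) 0 (α - β) (by rw [hs] at e; linear_combination (norm := module) e)).elim
            fun h h' => by simpa [neg_eq_zero.1 h] using h'.2
      · exact disjoint_span_singletons fun α β e =>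
          (hi 0 (-β) (α - β) (by rw [hq] at e; linear_combination (norm := module) e)).2.elim
            fun h h' => by simpa [neg_eq_zero.1 h] using h'
      · exact disjoint_span_singletons fun α β e =>
          (hi 0 (α - β) (-β) (by rw [hq] at e; linear_combination (norm := module) e)).2.elim
            fun h h' => by simpa [neg_eq_zero.1 h'] using h
      · exact disjoint_span_singletons fun α β e =>
          (hi (α - β) 0 (-β) (by rw [hs] at e; linear_combination (norm := module) e)).elim
            fun h h' => by simpa [neg_eq_zero.1 h'.2] using h

theorem ConfigVectors.nonFanoSlack_eq_zero (H : ConfigVectors F v a b c p q r s)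
    (h2 : (2 : F) ≠ 0) :
    nonFanoSlack a b c p q r s (subspaceRank F fun i => Submodule.span F {v i}) = 0 := by
  refine slack_eq_zero H.depSlack_eq_zero (fun d hd => ?_)
  rcases Finset.mem_union.1 hd with hd | hd
  · exact H.indSlack_eq_zero d hd
  · obtain ⟨hi, hp, hq, hr, hs⟩ := H
    revert d
    simp only [Finset.mem_insert, Finset.mem_singleton]
    rintro d - (rfl | rfl) <;> apply Polymat.indSlack_eq_zero <;>
      simp only [spanOf_insert, spanOf_singleton]
    · refine disjoint_span_singleton_sup fun α β γ e => ?_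
      -- The three coordinates of a relation `αp = βq + γs`; first plus second minus third is `2α`.
      obtain ⟨h1, h3, h4⟩ := hi (α - γ) (α - β) (-β - γ)
        (by rw [hp, hq, hs] at e; linear_combination (norm := module) e)
      have : 2 * α = 0 := by linear_combination h1 + h3 - h4
      exact (mul_eq_zero.1 this).resolve_left h2
    · exact disjoint_span_singletons fun α β e =>
        (hi α α (α - β) (by rw [hr] at e; linear_combination (norm := module) e)).1

end Tight

end Configurations

/-! ### Separating functionals and the combined inequality -/

section Separation

/-- A linear functional on rank functions is the linear form of its coefficients. -/
theorem exists_linearForm_eq {X : Type*} [Fintype X] (L : RankFun X →ₗ[ℝ] ℝ) :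
    ∃ c : Finset X → ℝ, ∀ h, linearForm c h = L h := by
  classical
  refine ⟨fun A => L fun B => if A = B then 1 else 0, fun h => ?_⟩
  rw [LinearMap.pi_apply_eq_sum_univ L h]
  exact Finset.sum_congr rfl fun A _ => mul_comm _ _

/-- A valid rank inequality violated by `h` separates `h` from the cc-representable functions. -/
theorem not_isCCRepresentable_of_linearForm_neg {X : Type*} [Fintype X] {c : Finset X → ℝ}
    (hc : IsSubspaceRankInequality c) {h : RankFun X} (hh : linearForm c h < 0) :
    ¬ IsCCRepresentable h := by
  intro H
  -- The closed half-space of the inequality is a convex cone containing the representable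
  -- functions, hence also the closure of their hull.
  let K : ConvexCone ℝ (RankFun X) :=
    { carrier := {g | 0 ≤ linearForm c g}
      smul_mem' := fun t ht g hg => by
        have : linearForm c (t • g) = t * linearForm c g := by
          simp only [linearForm, Finset.mul_sum, Pi.smul_apply, smul_eq_mul]
          exact Finset.sum_congr rfl fun _ _ => by ring
        rw [Set.mem_ofPred_eq, this]
        exact mul_nonneg ht.le hg
      add_mem' := fun g hg g' hg' => by
        have : linearForm c (g + g') = linearForm c g + linearForm c g' := by
          simp only [linearForm, ← Finset.sum_add_distrib, Pi.add_apply, mul_add]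
        rw [Set.mem_ofPred_eq, this]
        exact add_nonneg hg hg' }
  have hK : ConvexCone.hull ℝ {g : RankFun X | IsRepresentable g} ≤ K :=
    ConvexCone.hull_min fun g hg => hc g hg
  have hcont : Continuous (linearForm c) :=
    continuous_finsetSum _ fun A _ => continuous_const.mul (continuous_apply A)
  have hclosed : IsClosed (K : Set (RankFun X)) := isClosed_le continuous_const hcont
  exact absurd (closure_minimal hK hclosed H : 0 ≤ linearForm c h) (not_le.2 hh)

variable {X₁ X₂ : Type*}

/-- Restriction of rank functions to the left summand. -/
def restrictLeft : RankFun (X₁ ⊕ X₂) →ₗ[ℝ] RankFun X₁ :=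
  LinearMap.funLeft ℝ ℝ fun A => A.map Function.Embedding.inl

/-- Restriction of rank functions to the right summand. -/
def restrictRight : RankFun (X₁ ⊕ X₂) →ₗ[ℝ] RankFun X₂ :=
  LinearMap.funLeft ℝ ℝ fun A => A.map Function.Embedding.inr

theorem spanOf_map {F W X Y : Type*} [Field F] [AddCommGroup W] [Module F W]
    (V : Y → Submodule F W) (f : X ↪ Y) (A : Finset X) :
    spanOf V (A.map f) = spanOf (V ∘ f) A := by
  simp only [spanOf, ← Finset.sup_eq_iSup, Finset.sup_map]

theorem restrictLeft_subspaceRank {F W : Type*} [Field F] [AddCommGroup W] [Module F W]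
    (V : X₁ ⊕ X₂ → Submodule F W) :
    restrictLeft (subspaceRank F V) = subspaceRank F fun i => V (Sum.inl i) := by
  ext A
  change subspaceRank F V (A.map Function.Embedding.inl) = _
  rw [subspaceRank_eq, subspaceRank_eq, spanOf_map]
  rfl

theorem restrictRight_subspaceRank {F W : Type*} [Field F] [AddCommGroup W] [Module F W]
    (V : X₁ ⊕ X₂ → Submodule F W) :
    restrictRight (subspaceRank F V) = subspaceRank F fun i => V (Sum.inr i) := by
  ext A
  change subspaceRank F V (A.map Function.Embedding.inr) = _
  rw [subspaceRank_eq, subspaceRank_eq, spanOf_map]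
  rfl

variable [Fintype X₁] [Fintype X₂]

theorem directSum_univ (h₁ : RankFun X₁) (h₂ : RankFun X₂) :
    directSum h₁ h₂ Finset.univ = h₁ Finset.univ + h₂ Finset.univ := by
  have e1 : (Finset.univ : Finset (X₁ ⊕ X₂)).toLeft = Finset.univ := by ext; simp
  have e2 : (Finset.univ : Finset (X₁ ⊕ X₂)).toRight = Finset.univ := by ext; simp
  rw [directSum, e1, e2]

variable [DecidableEq X₁] [DecidableEq X₂]

/-- A subset of `X₁` has rank at most `h₁(X₁)`, which is at most the truncation level because `ε ≤
h₂(X₂)`. -/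
theorem restrictLeft_perturb_directSum {h₁ : RankFun X₁} {h₂ : RankFun X₂}
    (H₁ : IsPolymatroid h₁) (H₂ : IsPolymatroid h₂) {ε : ℝ} (hε : ε ≤ h₂ Finset.univ) :
    restrictLeft (perturb ε (directSum h₁ h₂)) = h₁ := by
  ext A
  have e1 : (A.map (Function.Embedding.inl : X₁ ↪ X₁ ⊕ X₂)).toLeft = A := by ext; simp
  have e2 : (A.map (Function.Embedding.inl : X₁ ↪ X₁ ⊕ X₂)).toRight = ∅ := by ext; simp
  change min (h₁ _ + h₂ _) _ = _
  rw [directSum_univ, e1, e2, H₂.empty, add_zero]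
  exact min_eq_left (by linarith [H₁.mono A Finset.univ (Finset.subset_univ A)])

theorem restrictRight_perturb_directSum {h₁ : RankFun X₁} {h₂ : RankFun X₂}
    (H₁ : IsPolymatroid h₁) (H₂ : IsPolymatroid h₂) {ε : ℝ} (hε : ε ≤ h₁ Finset.univ) :
    restrictRight (perturb ε (directSum h₁ h₂)) = h₂ := by
  ext A
  have e1 : (A.map (Function.Embedding.inr : X₂ ↪ X₁ ⊕ X₂)).toLeft = ∅ := by ext; simp
  have e2 : (A.map (Function.Embedding.inr : X₂ ↪ X₁ ⊕ X₂)).toRight = A := by ext; simp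
  change min (h₁ _ + h₂ _) _ = _
  rw [directSum_univ, e1, e2, H₁.empty, zero_add]
  exact min_eq_left (by linarith [H₂.mono A Finset.univ (Finset.subset_univ A)])

/-- Combination of two characteristic-dependent rank inequalities into one that holds over all
fields and is violated by every perturbation of the direct sum. -/
theorem exists_separating_inequality {h₁ : RankFun X₁} {h₂ : RankFun X₂}
    (H₁ : IsPolymatroid h₁) (H₂ : IsPolymatroid h₂)
    (S₁ : RankFun X₁ →ₗ[ℝ] ℝ) (S₂ : RankFun X₂ →ₗ[ℝ] ℝ)
    (nonneg₁ : ∀ h, IsPolymatroid h → 0 ≤ S₁ h) (nonneg₂ : ∀ h, IsPolymatroid h → 0 ≤ S₂ h)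
    (zero₁ : S₁ h₁ = 0) (zero₂ : S₂ h₂ = 0)
    (bound₁ : ∀ (F W : Type) [Field F] [AddCommGroup W] [Module F W] [FiniteDimensional F W]
      (V : X₁ → Submodule F W), (2 : F) ≠ 0 →
      subspaceRank F V Finset.univ ≤ S₁ (subspaceRank F V))
    (bound₂ : ∀ (F W : Type) [Field F] [AddCommGroup W] [Module F W] [FiniteDimensional F W]
      (V : X₂ → Submodule F W), (2 : F) = 0 →
      subspaceRank F V Finset.univ ≤ S₂ (subspaceRank F V))
    {ε : ℝ} (hε : 0 < ε) (hε₁ : ε ≤ h₁ Finset.univ) (hε₂ : ε ≤ h₂ Finset.univ) :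
    ∃ c : Finset (X₁ ⊕ X₂) → ℝ, IsSubspaceRankInequality c ∧
      linearForm c (perturb ε (directSum h₁ h₂)) < 0 := by
  obtain ⟨c, hc⟩ := exists_linearForm_eq
    (LinearMap.proj (R := ℝ) (φ := fun _ : Finset (X₁ ⊕ X₂) => ℝ) Finset.univ
      + (S₁ - LinearMap.proj (R := ℝ) (φ := fun _ : Finset X₁ => ℝ) Finset.univ) ∘ₗ restrictLeft
      + (S₂ - LinearMap.proj (R := ℝ) (φ := fun _ : Finset X₂ => ℝ) Finset.univ) ∘ₗ restrictRight)
  refine ⟨c, ?_, ?_⟩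
  · rintro h ⟨_, F, _, _, W, _, _, _, V, -, rfl⟩
    have H := isPolymatroid_subspaceRank V
    have hl : restrictLeft (subspaceRank F V) Finset.univ ≤ subspaceRank F V Finset.univ :=
      H.mono _ _ (Finset.subset_univ _)
    have hr : restrictRight (subspaceRank F V) Finset.univ ≤ subspaceRank F V Finset.univ :=
      H.mono _ _ (Finset.subset_univ _)
    rw [hc]
    simp only [LinearMap.add_apply, LinearMap.comp_apply, LinearMap.sub_apply,
      LinearMap.proj_apply]
    rw [restrictLeft_subspaceRank] at hl ⊢
    rw [restrictRight_subspaceRank] at hr ⊢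
    -- The characteristic decides which bracket is nonnegative; the other loses at most the rank of
    -- its own ground set, which the leading term repays.
    by_cases h2 : (2 : F) = 0
    · have hb := bound₂ F W (fun i => V (Sum.inr i)) h2
      have hn := nonneg₁ _ (isPolymatroid_subspaceRank fun i => V (Sum.inl i))
      linarith
    · have hb := bound₁ F W (fun i => V (Sum.inl i)) h2
      have hn := nonneg₂ _ (isPolymatroid_subspaceRank fun i => V (Sum.inr i))
      linarith
  · rw [hc]
    simp only [LinearMap.add_apply, LinearMap.comp_apply, LinearMap.sub_apply,
      LinearMap.proj_apply]
    rw [restrictLeft_perturb_directSum H₁ H₂ hε₂, restrictRight_perturb_directSum H₁ H₂ hε₁,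
      zero₁, zero₂]
    have : perturb ε (directSum h₁ h₂) Finset.univ ≤ h₁ Finset.univ + h₂ Finset.univ - ε := by
      rw [← directSum_univ]
      exact min_le_right _ _
    linarith

end Separation

/-! ### The functionals on the two explicit ground sets -/

section Witness

/-- The functional bounding representable ranks on `Ground₁` away from characteristic two. -/
def groundSlack₁ : RankFun Ground₁ →ₗ[ℝ] ℝ :=
  (465 : ℝ) • fanoSlack (.inl 0) (.inl 1) (.inl 2) (.inr 0) (.inr 1) (.inr 2) (.inr 3)
    + depSlack Finset.univ {.inl 0, .inl 1, .inl 2}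

/-- The functional bounding representable ranks on `Ground₂` in characteristic two. -/
def groundSlack₂ : RankFun Ground₂ →ₗ[ℝ] ℝ :=
  (87 : ℝ) • nonFanoSlack (.inl 0) (.inl 1) (.inl 2) (.inr 2) (.inr 4) (.inr 0) (.inr 3)
    + (87 : ℝ) • nonFanoSlack (.inl 2) (.inl 3) (.inl 4) (.inr 5) (.inr 7) (.inr 1) (.inr 6)
    + depSlack Finset.univ {.inl 0, .inl 1, .inl 2, .inl 3, .inl 4}

theorem groundSlack₁_apply (h : RankFun Ground₁) : groundSlack₁ h =
    465 * fanoSlack (.inl 0) (.inl 1) (.inl 2) (.inr 0) (.inr 1) (.inr 2) (.inr 3) h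
      + depSlack Finset.univ {.inl 0, .inl 1, .inl 2} h := rfl

theorem groundSlack₂_apply (h : RankFun Ground₂) : groundSlack₂ h =
    87 * nonFanoSlack (.inl 0) (.inl 1) (.inl 2) (.inr 2) (.inr 4) (.inr 0) (.inr 3) h
      + 87 * nonFanoSlack (.inl 2) (.inl 3) (.inl 4) (.inr 5) (.inr 7) (.inr 1) (.inr 6) h
      + depSlack Finset.univ {.inl 0, .inl 1, .inl 2, .inl 3, .inl 4} h := rfl

theorem groundSlack₁_nonneg (h : RankFun Ground₁) (H : IsPolymatroid h) :
    0 ≤ groundSlack₁ h := by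
  rw [groundSlack₁_apply]
  have h1 : 0 ≤ fanoSlack (.inl 0) (.inl 1) (.inl 2) (.inr 0) (.inr 1) (.inr 2) (.inr 3) h :=
    H.slack_nonneg _ _
  have h2 := H.depSlack_nonneg Finset.univ {.inl 0, .inl 1, .inl 2}
  linarith

theorem groundSlack₂_nonneg (h : RankFun Ground₂) (H : IsPolymatroid h) :
    0 ≤ groundSlack₂ h := by
  rw [groundSlack₂_apply]
  have h1 : 0 ≤ nonFanoSlack (.inl 0) (.inl 1) (.inl 2) (.inr 2) (.inr 4) (.inr 0) (.inr 3) h :=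
    H.slack_nonneg _ _
  have h2 : 0 ≤ nonFanoSlack (.inl 2) (.inl 3) (.inl 4) (.inr 5) (.inr 7) (.inr 1) (.inr 6) h :=
    H.slack_nonneg _ _
  have h3 := H.depSlack_nonneg Finset.univ {.inl 0, .inl 1, .inl 2, .inl 3, .inl 4}
  linarith

/-- The whole set exceeds the three basis members by the `depSlack` term, and each of them costs
`155`: hence `465 = 3 * 155`. -/
theorem subspaceRank_univ_le_groundSlack₁ (F W : Type) [Field F] [AddCommGroup W] [Module F W]
    [FiniteDimensional F W] (V : Ground₁ → Submodule F W) (h2 : (2 : F) ≠ 0) :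
    subspaceRank F V Finset.univ ≤ groundSlack₁ (subspaceRank F V) := by
  have H := isPolymatroid_subspaceRank V
  obtain ⟨ha, hb, hc⟩ := subspaceRank_le_fanoSlack V h2 (.inl 0) (.inl 1) (.inl 2) (.inr 0)
    (.inr 1) (.inr 2) (.inr 3)
  have h1 := H.insert_le (.inl 0) {.inl 1, .inl 2}
  have h2 := H.insert_le (.inl 1) {.inl 2}
  rw [groundSlack₁_apply, depSlack_apply,
    Finset.union_eq_left.2 (Finset.subset_univ _)]
  linarith

/-- The non-Fano copies on `Z₁, Z₂, Z₃` and `Z₃, Z₄, Z₅` together control all five basis members;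
`87 = 3 * 29`. -/
theorem subspaceRank_univ_le_groundSlack₂ (F W : Type) [Field F] [AddCommGroup W] [Module F W]
    [FiniteDimensional F W] (V : Ground₂ → Submodule F W) (h2 : (2 : F) = 0) :
    subspaceRank F V Finset.univ ≤ groundSlack₂ (subspaceRank F V) := by
  have H := isPolymatroid_subspaceRank V
  obtain ⟨ha, hb, hc⟩ := subspaceRank_le_nonFanoSlack V h2 (.inl 0) (.inl 1) (.inl 2) (.inr 2)
    (.inr 4) (.inr 0) (.inr 3)
  obtain ⟨hc', hd, he⟩ := subspaceRank_le_nonFanoSlack V h2 (.inl 2) (.inl 3) (.inl 4) (.inr 5)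
    (.inr 7) (.inr 1) (.inr 6)
  have h1 := H.insert_le (.inl 0) {.inl 1, .inl 2, .inl 3, .inl 4}
  have h2 := H.insert_le (.inl 1) {.inl 2, .inl 3, .inl 4}
  have h3 := H.insert_le (.inl 2) {.inl 3, .inl 4}
  have h4 := H.insert_le (.inl 3) {.inl 4}
  -- The shared member is counted once, so the second copy needs only `2 * 29`. With `hc'`, this
  -- makes the second slack nonnegative and lets the surplus be dropped.
  have h5 := H.nonneg {.inl 2}
  rw [groundSlack₂_apply, depSlack_apply,
    Finset.union_eq_left.2 (Finset.subset_univ _)]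
  linarith

variable {F W : Type*} [Field F] [AddCommGroup W] [Module F W]

theorem spanOf_span_singleton_le {X : Type*} {v : X → W} {A : Finset X} {M : Submodule F W}
    (h : ∀ x, v x ∈ M) : spanOf (fun i => Submodule.span F {v i}) A ≤ M :=
  iSup₂_le fun x _ => (Submodule.span_singleton_le_iff_mem _ _).2 (h x)

theorem mem_spanOf_span_singleton {X : Type*} {v : X → W} {A : Finset X} {x : X} (h : x ∈ A) :
    v x ∈ spanOf (fun i => Submodule.span F {v i}) A :=
  (le_iSup₂_of_le x h le_rfl : Submodule.span F {v x} ≤ _) (Submodule.mem_span_singleton_self _)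

theorem groundSlack₁_Φ₁ {u : Fin 3 → W} (hu : LinearIndependent F u) (h2 : (2 : F) = 0) :
    groundSlack₁ (Φ₁ F u) = 0 := by
  have hfano : fanoSlack (.inl 0) (.inl 1) (.inl 2) (.inr 0) (.inr 1) (.inr 2) (.inr 3)
      (Φ₁ F u) = 0 := by
    refine ConfigVectors.fanoSlack_eq_zero ⟨fun α β γ h => ?_, ?_, ?_, ?_, ?_⟩ h2
    · have := Fintype.linearIndependent_iff.1 hu ![α, β, γ]
        (by simpa [Fin.sum_univ_three, vectors₁] using h)
      exact ⟨this 0, this 1, this 2⟩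
    all_goals simp [vectors₁]
  have hdep : depSlack Finset.univ {.inl 0, .inl 1, .inl 2} (Φ₁ F u) = 0 := by
    apply depSlack_eq_zero
    have m : ∀ i, u i ∈ spanOf (fun i => Submodule.span F {vectors₁ u i})
        {.inl 0, .inl 1, .inl 2} := by
      intro i
      exact mem_spanOf_span_singleton (v := vectors₁ u) (x := .inl i) (by fin_cases i <;> simp)
    refine spanOf_span_singleton_le ?_
    rintro (i | i)
    · exact m i
    · fin_cases i
      · exact add_mem (m 0) (m 1)
      · exact add_mem (m 1) (m 2)
      · exact add_mem (add_mem (m 0) (m 1)) (m 2)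
      · exact add_mem (m 0) (m 2)
  rw [groundSlack₁_apply, hfano, hdep]
  simp

theorem groundSlack₂_Φ₂ {u : Fin 5 → W} (hu : LinearIndependent F u) (h2 : (2 : F) ≠ 0) :
    groundSlack₂ (Φ₂ F u) = 0 := by
  have hfst : nonFanoSlack (.inl 0) (.inl 1) (.inl 2) (.inr 2) (.inr 4) (.inr 0) (.inr 3)
      (Φ₂ F u) = 0 := by
    refine ConfigVectors.nonFanoSlack_eq_zero ⟨fun α β γ h => ?_, ?_, ?_, ?_, ?_⟩ h2
    · have := Fintype.linearIndependent_iff.1 hu ![α, β, γ, 0, 0]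
        (by simpa [Fin.sum_univ_five, vectors₂] using h)
      exact ⟨this 0, this 1, this 2⟩
    all_goals simp [vectors₂]
  have hsnd : nonFanoSlack (.inl 2) (.inl 3) (.inl 4) (.inr 5) (.inr 7) (.inr 1) (.inr 6)
      (Φ₂ F u) = 0 := by
    refine ConfigVectors.nonFanoSlack_eq_zero ⟨fun α β γ h => ?_, ?_, ?_, ?_, ?_⟩ h2
    · have := Fintype.linearIndependent_iff.1 hu ![0, 0, α, β, γ]
        (by simpa [Fin.sum_univ_five, vectors₂] using h)
      exact ⟨this 2, this 3, this 4⟩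
    all_goals simp [vectors₂]
  have hdep : depSlack Finset.univ {.inl 0, .inl 1, .inl 2, .inl 3, .inl 4} (Φ₂ F u) = 0 := by
    apply depSlack_eq_zero
    have m : ∀ i, u i ∈ spanOf (fun i => Submodule.span F {vectors₂ u i})
        {.inl 0, .inl 1, .inl 2, .inl 3, .inl 4} := by
      intro i
      exact mem_spanOf_span_singleton (v := vectors₂ u) (x := .inl i) (by fin_cases i <;> simp)
    refine spanOf_span_singleton_le ?_
    rintro (i | i)
    · exact m i
    · fin_cases i
      · exact add_mem (add_mem (m 0) (m 1)) (m 2)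
      · exact add_mem (add_mem (m 2) (m 3)) (m 4)
      · exact add_mem (m 0) (m 1)
      · exact add_mem (m 0) (m 2)
      · exact add_mem (m 1) (m 2)
      · exact add_mem (m 2) (m 3)
      · exact add_mem (m 2) (m 4)
      · exact add_mem (m 3) (m 4)
  rw [groundSlack₂_apply, hfst, hsnd, hdep]
  simp

theorem isIngletonian_Φ₁ (u : Fin 3 → W) : IsIngletonian (Φ₁ F u) :=
  isIngletonian_subspaceRank _

theorem isIngletonian_Φ₂ (u : Fin 5 → W) : IsIngletonian (Φ₂ F u) :=
  isIngletonian_subspaceRank _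

theorem subspaceRank_univ_pos {X : Type*} [Fintype X] {v : X → W} {x : X} (hx : v x ≠ 0) :
    0 < subspaceRank F (fun i => Submodule.span F {v i}) Finset.univ := by
  classical
  have h := (isPolymatroid_subspaceRank fun i => Submodule.span F {v i}).mono {x} Finset.univ
    (Finset.subset_univ _)
  rw [subspaceRank_eq, spanOf_singleton, dim, finrank_span_singleton hx] at h
  push_cast at h
  linarith

end Witness

/-! ### Assembly -/

theorem two_ne_zero_of_odd_ringChar {F : Type*} [Field F] (h : Odd (ringChar F)) :
    (2 : F) ≠ 0 := by
  intro h2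
  have hd : ringChar F ∣ 2 := ringChar.dvd (by exact_mod_cast h2)
  rcases (Nat.dvd_prime Nat.prime_two).1 hd with h1 | h1
  · exact CharP.ringChar_ne_one h1
  · rw [h1] at h
    exact absurd h (by decide)

/-- The perturbed direct sum is Ingletonian and violates a valid subspace rank inequality. -/
theorem perturb_directSum_witness {F₁ W₁ F₂ W₂ : Type} [Field F₁] [AddCommGroup W₁]
    [Module F₁ W₁] [Field F₂] [AddCommGroup W₂] [Module F₂ W₂]
    {u : Fin 3 → W₁} {v : Fin 5 → W₂} {ε : ℝ} (h₁ : (2 : F₁) = 0) (h₂ : (2 : F₂) ≠ 0)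
    (hu : LinearIndependent F₁ u) (hv : LinearIndependent F₂ v) (hε : 0 < ε)
    (hε' : ε ≤ min (Φ₁ F₁ u Finset.univ) (Φ₂ F₂ v Finset.univ)) :
    IsIngletonian (perturb ε (directSum (Φ₁ F₁ u) (Φ₂ F₂ v))) ∧
      ∃ c : Finset (Ground₁ ⊕ Ground₂) → ℝ, IsSubspaceRankInequality c ∧
        linearForm c (perturb ε (directSum (Φ₁ F₁ u) (Φ₂ F₂ v))) < 0 := by
  have I₁ := isIngletonian_Φ₁ (F := F₁) u
  have I₂ := isIngletonian_Φ₂ (F := F₂) v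
  obtain ⟨hε₁, hε₂⟩ := le_min_iff.1 hε'
  constructor
  · refine (I₁.directSum I₂).perturb ?_
    rw [directSum_univ]
    linarith [I₂.isPolymatroid.nonneg Finset.univ]
  · exact exists_separating_inequality I₁.isPolymatroid I₂.isPolymatroid groundSlack₁ groundSlack₂
      groundSlack₁_nonneg groundSlack₂_nonneg (groundSlack₁_Φ₁ hu h₁) (groundSlack₂_Φ₂ hv h₂)
      subspaceRank_univ_le_groundSlack₁ subspaceRank_univ_le_groundSlack₂ hε hε₁ hε₂

/-- Some Ingletonian polymatroid violates a valid subspace rank inequality. -/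
theorem exists_isIngletonian_linearForm_neg :
    ∃ (h : RankFun (Ground₁ ⊕ Ground₂)) (c : Finset (Ground₁ ⊕ Ground₂) → ℝ),
      IsIngletonian h ∧ IsSubspaceRankInequality c ∧ linearForm c h < 0 := by
  -- Standard bases over the fields with two and three elements, with `ε` taken as the largest
  -- admissible value.
  have hu := (Pi.basisFun (ZMod 2) (Fin 3)).linearIndependent
  have hv := (Pi.basisFun (ZMod 3) (Fin 5)).linearIndependent
  have hε : 0 < min (Φ₁ (ZMod 2) (Pi.basisFun (ZMod 2) (Fin 3)) Finset.univ)
      (Φ₂ (ZMod 3) (Pi.basisFun (ZMod 3) (Fin 5)) Finset.univ) :=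
    lt_min (subspaceRank_univ_pos (v := vectors₁ _) (x := .inl 0) (hu.ne_zero 0))
      (subspaceRank_univ_pos (v := vectors₂ _) (x := .inl 0) (hv.ne_zero 0))
  obtain ⟨hI, c, hc, hneg⟩ := perturb_directSum_witness (by decide) (by decide) hu hv hε le_rfl
  exact ⟨_, c, hI, hc, hneg⟩

end Polymat

end

theorem mainTheorem1 :
    -- some Ingletonian polymatroid is not cc-representable
    (∃ (X : Type) (_ : Fintype X) (_ : DecidableEq X) (h : Polymat.RankFun X),
      Polymat.IsIngletonian h ∧ ¬ Polymat.IsCCRepresentable h) ∧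
    -- some linear inequality valid for all representable polymatroids
    -- is not implied by Ingleton's inequalities
    (∃ (X : Type) (_ : Fintype X) (_ : DecidableEq X) (c : Finset X → ℝ),
      Polymat.IsSubspaceRankInequality c ∧ ¬ Polymat.IsImpliedByIngleton c) ∧
    -- the witness
    (∀ (F₁ W₁ F₂ W₂ : Type) [Field F₁] [Finite F₁] [AddCommGroup W₁] [Module F₁ W₁]
      [Field F₂] [Finite F₂] [AddCommGroup W₂] [Module F₂ W₂]
      (u : Fin 3 → W₁) (v : Fin 5 → W₂) (ε : ℝ),
      CharP F₁ 2 → Odd (ringChar F₂) →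
      LinearIndependent F₁ u → LinearIndependent F₂ v →
      0 < ε → ε ≤ min (Polymat.Φ₁ F₁ u Finset.univ) (Polymat.Φ₂ F₂ v Finset.univ) →
      Polymat.IsIngletonian
          (Polymat.perturb ε (Polymat.directSum (Polymat.Φ₁ F₁ u) (Polymat.Φ₂ F₂ v))) ∧
        ¬ Polymat.IsCCRepresentable
          (Polymat.perturb ε (Polymat.directSum (Polymat.Φ₁ F₁ u) (Polymat.Φ₂ F₂ v))) ∧
        ∃ c : Finset (Polymat.Ground₁ ⊕ Polymat.Ground₂) → ℝ,
          Polymat.IsSubspaceRankInequality c ∧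
          Polymat.linearForm c
            (Polymat.perturb ε (Polymat.directSum (Polymat.Φ₁ F₁ u) (Polymat.Φ₂ F₂ v))) < 0) := by
  obtain ⟨h, c, hI, hc, hneg⟩ := Polymat.exists_isIngletonian_linearForm_neg
  refine ⟨⟨_, inferInstance, inferInstance, h, hI,
      Polymat.not_isCCRepresentable_of_linearForm_neg hc hneg⟩,
    ⟨_, inferInstance, inferInstance, c, hc, fun H => absurd (H h hI) (not_le.2 hneg)⟩, ?_⟩
  intro F₁ W₁ F₂ W₂ _ _ _ _ _ _ _ _ u v ε hF₁ hF₂ hu hv hε hε'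
  obtain ⟨hI, c, hc, hneg⟩ := Polymat.perturb_directSum_witness (CharP.cast_eq_zero F₁ 2)
    (Polymat.two_ne_zero_of_odd_ringChar hF₂) hu hv hε hε'
  exact ⟨hI, Polymat.not_isCCRepresentable_of_linearForm_neg hc hneg, c, hc, hneg⟩
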